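/- **Setting.** Let $1<\gamma\le 5/3$, $\theta=(\gamma-1)/2$, $\bar\rho>0$ and $1<\mu<1/(2\theta)$. For a state $u=(\rho,m)$ with $\rho\ge 0$ put $$w(u)=\frac m\rho+\frac{\rho^\theta}{\theta},\quad z(u)=\frac m\rho-\frac{\rho^\theta}{\theta},\quad \eta_*(u)=\frac{m^2}{2\rho}+\frac{\rho^\gamma}{\gamma(\gamma-1)},\quad q_*(u)=m\Big(\frac{m^2}{2\rho^2}+\frac{\rho^{\gamma-1}}{\gamma-1}\Big),$$ $$J(u)=\eta_*(u)-\frac{\bar\rho^{\gamma-1}}{\gamma-1}\rho+\frac{\bar\rho^\gamma}{\gamma}.$$ Let $u_0=(\rho_0,m_0)$ be measurable and equal to $(\bar\rho,0)$ outside a finite interval, with $$0\le\rho_0\le B,\qquad |m_0|\le B\rho_0\qquad\text{a.e.}$$ Put $E_0=\int_{\mathbb R}J(u_0)\,dx$ and $$M_0=\max\Big\{\frac{\bar\rho^\theta}{\theta},\ -\operatorname*{ess\,inf}_x\Big(z(u_0(x))-\int_{-\infty}^xJ(u_0)\Big)+E_0,\ \operatorname*{ess\,sup}_x\Big(w(u_0(x))-\int_{-\infty}^xJ(u_0)\Big)\Big\}.$$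 Let $\Delta x>0$, $\Delta t=\Delta x/(2(M_0+E_0))$, $x_j=j\Delta x$, $t_n=n\Delta t$, and $T,\varepsilon,\delta>0$. **Approximate solutions.** Let $u^\Delta=(\rho^\Delta,m^\Delta)$ be a function on $\mathbb R\times[0,T)$ with the following properties. * (data assumptions) $0\le\rho^\Delta\le B$ and $|m^\Delta|\le B\rho^\Delta$. * It equals $(\bar\rho,0)$ outside a finite interval. In each strip $t_n<t<t_{n+1}\le T$ it is continuous except along finitely many disjoint $C^1$ curves $x=x(t)$, where it has one-sided limits that depend continuously on $t$; and for a.e. $x$ the limit $u^\Delta(x,t_{n+1-})$ exists. Set $u^\Delta(x,t_{0-})=u_0(x)$. For even $j$ let $$E^n_j(u)=(E^n_j(\rho),E^n_j(m))=\frac1{2\Delta x}\int_{x_{j-1}}^{x_{j+1}}u^\Delta(x,t_{n-})\,dx,\qquad E^n(x;u)=E^n_j(u)\ \text{ on }[x_{j-1},x_{j+1}),$$ $$I^n_j=\int_{-\infty}^{x_j}J(E^n(x;u))\,dx,$$ $$R^n_j(x)=\int_0^1(1-\tau)\,{}^t\!d\;\nabla^2\eta_*\big(E^n_j(u)+\tau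 d\big)\,d\;d\tau,\qquad d=u^\Delta(x,t_{n-})-E^n_j(u).$$ Let $\sum(\sigma[\eta_*]-[q_*])$ denote the sum over the discontinuities at a fixed time, where $\sigma=x'(t)$ and $[\cdot]$ is the jump from left to right. Let $$L_n=\int_0^{t_n}\sum_{x\in\mathbb R}(\sigma[\eta_*]-[q_*])\,dt+\sum_{k=0}^n\int_{\mathbb R}\{\eta_*(u^\Delta(x,t_{k-}))-\eta_*(E^k(x;u))\}\,dx+\sum_{k=0}^n\sum_{j\in2\mathbb Z}\frac1{2\Delta x}\int_{x_{j-1}}^{x_{j+1}}\int_{x_{j-1}}^xR^k_j(y)\,dy\,dx.$$ Let $M_1=M_0-\delta\Delta t$ and, for $n\ge1$, $M_{n+1}=M_n-\delta\Delta t$ if $M_n+L_n\ge\bar\rho^\theta/\theta+\varepsilon$, and $M_{n+1}=M_n$ otherwise. **Hypotheses.** Let $\omega$ be a function with $\omega(h)=o(h)$ as $h\to0+$. Assume the following whenever $t_{n+1}\le T$. * (entropy condition, up to $o(\Delta x)$) For every $a\in\mathbb R$, $\int_{t_n}^{t_{n+1}}\sum_{x\ge a}(\sigma[\eta_*]-[q_*])\,dt\ge-\omega(\Delta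 x)$. * (bounds on the Riemann invariants) For every even $j$ and a.e. $x\in[x_{j-1},x_{j+1})$ with $\rho^\Delta(x,t_{n+1-})>0$, $$z(u^\Delta(x,t_{n+1-}))\ge-M_{n+1}-E_0-L_n+\int_{-\infty}^xJ(u^\Delta(y,t_{n+1-}))\,dy-\omega(\Delta x),$$ $$w(u^\Delta(x,t_{n+1-}))\le M_{n+1}+L_n+\int_{-\infty}^xJ(u^\Delta(y,t_{n+1-}))\,dy+\int_{t_n}^{t_{n+1}}\sum_{x<x_{j+1}}(\sigma[\eta_*]-[q_*])\,dt+\omega(\Delta x).$$ **Theorem.** There is a function $\omega'$ with $\omega'(h)=o(h)$ as $h\to0+$, depending only on $\gamma,\bar\rho,\mu,B,\omega$ (not on $n,j,T,\varepsilon,\delta,\Delta x,u_0,u^\Delta$), such that for all $n$ with $t_n\le T$ and all even $j$ with $E^n_j(\rho)\ge(\Delta x)^\mu$, $$-M_n-E_0-L_n+I^n_j-\omega'(\Delta x)\le z(E^n_j(u)),\qquad w(E^n_j(u))\le M_n+L_n+I^n_j+\omega'(\Delta x).$$ Consequently the cut-off values $z^n_j=\max\{z(E^n_j(u)),-M_n-E_0-L_n+I^n_j\}$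 and $w^n_j=\min\{w(E^n_j(u)),M_n+L_n+I^n_j\}$ used in the cell-averaging step satisfy $$0\le z^n_j-z(E^n_j(u))\le\omega'(\Delta x),\qquad 0\le w(E^n_j(u))-w^n_j\le\omega'(\Delta x).$$ -/

import Mathlib

open Set Filter Topology MeasureTheory Asymptotics

noncomputable section

namespace IsentropicGas

/-! States are pairs `u = (ρ, m)` of a density and a momentum; `γ` is the adiabatic exponent and
`ρb` the constant density at spatial infinity. -/

/-- The exponent `θ = (γ - 1) / 2`. -/
def theta (γ : ℝ) : ℝ := (γ - 1) / 2

/-- The Riemann invariant `w(u) = m / ρ + ρ ^ θ / θ`. -/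
def riemannW (γ : ℝ) (u : ℝ × ℝ) : ℝ := u.2 / u.1 + u.1 ^ theta γ / theta γ

/-- The Riemann invariant `z(u) = m / ρ - ρ ^ θ / θ`. -/
def riemannZ (γ : ℝ) (u : ℝ × ℝ) : ℝ := u.2 / u.1 - u.1 ^ theta γ / theta γ

/-- The mechanical energy `η_*(u)`. At the vacuum state `(0, 0)` its value is `0`. -/
def energy (γ : ℝ) (u : ℝ × ℝ) : ℝ :=
  1 / 2 * (u.2 ^ 2 / u.1) + 1 / (γ * (γ - 1)) * u.1 ^ γ

/-- The energy flux `q_*(u)`. -/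
def energyFlux (γ : ℝ) (u : ℝ × ℝ) : ℝ :=
  u.2 * (1 / 2 * (u.2 ^ 2 / u.1 ^ 2) + u.1 ^ (γ - 1) / (γ - 1))

/-- The energy `J(u)` relative to the constant state `(ρb, 0)`. -/
def relEnergy (γ ρb : ℝ) (u : ℝ × ℝ) : ℝ :=
  energy γ u - ρb ^ (γ - 1) / (γ - 1) * u.1 + ρb ^ γ / γ

/-- The quadratic form `d ↦ ᵗd ∇²η_*(u) d` of the Hessian of the mechanical energy, whose entries
are `∂ρρ η_* = m² / ρ³ + ρ ^ (γ - 2)`, `∂ρm η_* = - m / ρ²` and `∂mm η_* = 1 / ρ`. -/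
def energyHess (γ : ℝ) (u d : ℝ × ℝ) : ℝ :=
  (u.2 ^ 2 / u.1 ^ 3 + u.1 ^ (γ - 2)) * d.1 ^ 2 - 2 * (u.2 / u.1 ^ 2) * (d.1 * d.2)
    + 1 / u.1 * d.2 ^ 2

/-- The integral remainder of the first order Taylor expansion of `η_*(u)` about the state `E`. -/
def taylorRemainder (γ : ℝ) (E u : ℝ × ℝ) : ℝ :=
  ∫ τ in (0 : ℝ)..1, (1 - τ) * energyHess γ (E + τ • (u - E)) (u - E)

/-- The quantity `σ[η_*] - [q_*]` of the profile `v` at the point `x`, for the speed `σ`, the jumps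
being taken from left to right. -/
def jumpProduction (γ : ℝ) (v : ℝ → ℝ × ℝ) (σ x : ℝ) : ℝ :=
  σ * (energy γ (Function.rightLim v x) - energy γ (Function.leftLim v x))
    - (energyFlux γ (Function.rightLim v x) - energyFlux γ (Function.leftLim v x))

/-- The raw data of an approximate solution: the space mesh length `dx`, the initial state `u0`,
the function `u x t`, and, for every time strip `(t_n, t_{n+1})`, finitely many curves
`x = front n i t` that carry its discontinuities. The conditions on these data are stated
separately below. -/
structure Approx where
  dx : ℝ
  u0 : ℝ → ℝ × ℝ
  u : ℝ → ℝ → ℝ × ℝ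
  numFronts : ℕ → ℕ
  front : (n : ℕ) → Fin (numFronts n) → ℝ → ℝ

namespace Approx

variable (γ ρb ε δ : ℝ) (A : Approx)

/-- The mesh point `x_j = j Δx`. -/
def node (j : ℤ) : ℝ := j * A.dx

/-- The total relative energy `E_0` of the initial data. -/
def initEnergy : ℝ := ∫ x, relEnergy γ ρb (A.u0 x)

/-- `z̃(x, 0)`, the first Riemann invariant minus the relative energy to the left of `x`. -/
def initZ (x : ℝ) : ℝ := riemannZ γ (A.u0 x) - ∫ y in Iic x, relEnergy γ ρb (A.u0 y)

/-- `w̃(x, 0)`, the second Riemann invariant minus the relative energy to the left of `x`. -/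
def initW (x : ℝ) : ℝ := riemannW γ (A.u0 x) - ∫ y in Iic x, relEnergy γ ρb (A.u0 y)

/-- The constant `M_0`. -/
def initBound : ℝ :=
  max (ρb ^ theta γ / theta γ)
    (max (-essInf (A.initZ γ ρb) volume + A.initEnergy γ ρb) (essSup (A.initW γ ρb) volume))

/-- The time mesh length `Δt`, given by `Δx / Δt = 2 (M_0 + E_0)`. -/
def dt : ℝ := A.dx / (2 * (A.initBound γ ρb + A.initEnergy γ ρb))

/-- The time `t_n = n Δt`. -/
def time (n : ℕ) : ℝ := n * A.dt γ ρb

/-- The state `u(x, t_n - 0)` just before `t_n`; it is the initial state for `n = 0`. -/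
def before (n : ℕ) (x : ℝ) : ℝ × ℝ :=
  if n = 0 then A.u0 x else Function.leftLim (A.u x) (A.time γ ρb n)

/-- The average `E^n_j(u)` of `u(·, t_n - 0)` over the cell `[x_{j-1}, x_{j+1}]`. -/
def avg (n : ℕ) (j : ℤ) : ℝ × ℝ :=
  (1 / (2 * A.dx) * ∫ x in A.node (j - 1)..A.node (j + 1), (A.before γ ρb n x).1,
   1 / (2 * A.dx) * ∫ x in A.node (j - 1)..A.node (j + 1), (A.before γ ρb n x).2)

/-- The even integer `j` with `x ∈ [x_{j-1}, x_{j+1})`. -/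
def cellIndex (x : ℝ) : ℤ := 2 * ⌊(x + A.dx) / (2 * A.dx)⌋

/-- The step function `E^n(x; u)`, equal to `E^n_j(u)` on `[x_{j-1}, x_{j+1})` for even `j`. -/
def stepAvg (n : ℕ) (x : ℝ) : ℝ × ℝ := A.avg γ ρb n (A.cellIndex x)

/-- `I^n_j`, the relative energy of the step function `E^n(· ; u)` to the left of `x_j`. -/
def leftEnergy (n : ℕ) (j : ℤ) : ℝ :=
  ∫ x in Iic (A.node j), relEnergy γ ρb (A.stepAvg γ ρb n x)

/-- The sum of `σ[η_*] - [q_*]` over the discontinuities at time `t` of the `n`-th strip that lie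
in the set `S`; the speed `σ` is the derivative of the front. -/
def productionRate (n : ℕ) (S : Set ℝ) (t : ℝ) : ℝ :=
  ∑ i : Fin (A.numFronts n),
    S.indicator (jumpProduction γ (fun y => A.u y t) (deriv (A.front n i) t)) (A.front n i t)

/-- The integral over `(t_n, t_{n+1})` of the sum of `σ[η_*] - [q_*]` over the discontinuities
in `S`. -/
def production (n : ℕ) (S : Set ℝ) : ℝ :=
  ∫ t in A.time γ ρb n..A.time γ ρb (n + 1), A.productionRate γ n S t

/-- The functional `L_n`: the production at all discontinuities up to `t_n`, the energy lost in all
averagings up to `t_n`, and the double integrals over the cells (`j = 2 i`) of the Taylor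
remainders. -/
def functionalL (n : ℕ) : ℝ :=
  (∑ k ∈ Finset.range n, A.production γ ρb k univ)
    + (∑ k ∈ Finset.range (n + 1),
        ∫ x, (energy γ (A.before γ ρb k x) - energy γ (A.stepAvg γ ρb k x)))
    + ∑ k ∈ Finset.range (n + 1), ∑' i : ℤ,
        1 / (2 * A.dx) *
          ∫ x in A.node (2 * i - 1)..A.node (2 * i + 1), ∫ y in A.node (2 * i - 1)..x,
            taylorRemainder γ (A.avg γ ρb k (2 * i)) (A.before γ ρb k y)

/-- The decreasing sequence `M_n`. -/
def boundM : ℕ → ℝ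
  | 0 => A.initBound γ ρb
  | 1 => A.initBound γ ρb - δ * A.dt γ ρb
  | n + 2 =>
    if ρb ^ theta γ / theta γ + ε ≤ boundM (n + 1) + A.functionalL γ ρb (n + 1) then
      boundM (n + 1) - δ * A.dt γ ρb
    else boundM (n + 1)

/-- The cut-off value `z^n_j` with which the scheme restarts in the cell `j`. -/
def cutZ (n : ℕ) (j : ℤ) : ℝ :=
  max (riemannZ γ (A.avg γ ρb n j))
    (-A.boundM γ ρb ε δ n - A.initEnergy γ ρb - A.functionalL γ ρb n + A.leftEnergy γ ρb n j)

/-- The cut-off value `w^n_j` with which the scheme restarts in the cell `j`. -/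
def cutW (n : ℕ) (j : ℤ) : ℝ :=
  min (riemannW γ (A.avg γ ρb n j))
    (A.boundM γ ρb ε δ n + A.functionalL γ ρb n + A.leftEnergy γ ρb n j)

/-- The initial data are measurable and equal to `(ρb, 0)` outside a finite interval, and
`ρ₀ ≥ 0`, `ρ₀ ∈ L^∞`, `m₀ / ρ₀ ∈ L^∞`, with bound `B`. -/
structure InitialData (B : ℝ) : Prop where
  measurable : Measurable A.u0
  far : ∃ X : ℝ, ∀ x, X < |x| → A.u0 x = (ρb, 0)
  bound : ∀ᵐ x, 0 ≤ (A.u0 x).1 ∧ (A.u0 x).1 ≤ B ∧ |(A.u0 x).2| ≤ B * (A.u0 x).1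

/-- On `[0, T)` the density is nonnegative, and `ρ` and `m / ρ` are bounded by `B`. -/
def DataBound (B T : ℝ) : Prop :=
  ∀ t ∈ Ico 0 T, ∀ x, 0 ≤ (A.u x t).1 ∧ (A.u x t).1 ≤ B ∧ |(A.u x t).2| ≤ B * (A.u x t).1

/-- Up to the time `T`, `u` is piecewise continuous in every strip `(t_n, t_{n+1})`, with one-sided
limits along finitely many disjoint `C¹` fronts, it is equal to `(ρb, 0)` outside a finite interval,
and it has limits at the end of every strip. -/
structure Piecewise (T : ℝ) : Prop where
  far : ∃ X : ℝ, ∀ t ∈ Ico 0 T, ∀ x, X < |x| → A.u x t = (ρb, 0)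
  front_contDiff : ∀ n, A.time γ ρb (n + 1) ≤ T → ∀ i, ContDiff ℝ 1 (A.front n i)
  front_strictMono : ∀ n, A.time γ ρb (n + 1) ≤ T →
    ∀ t ∈ Ioo (A.time γ ρb n) (A.time γ ρb (n + 1)), StrictMono fun i => A.front n i t
  continuousAt : ∀ n, A.time γ ρb (n + 1) ≤ T →
    ∀ t ∈ Ioo (A.time γ ρb n) (A.time γ ρb (n + 1)), ∀ x, (∀ i, x ≠ A.front n i t) →
      ContinuousAt (fun p : ℝ × ℝ => A.u p.1 p.2) (x, t)
  left_trace : ∀ n, A.time γ ρb (n + 1) ≤ T → ∀ i, ∃ l : ℝ → ℝ × ℝ,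
    ContinuousOn l (Ioo (A.time γ ρb n) (A.time γ ρb (n + 1))) ∧
    ∀ t ∈ Ioo (A.time γ ρb n) (A.time γ ρb (n + 1)),
      Tendsto (fun y => A.u y t) (𝓝[<] A.front n i t) (𝓝 (l t))
  right_trace : ∀ n, A.time γ ρb (n + 1) ≤ T → ∀ i, ∃ r : ℝ → ℝ × ℝ,
    ContinuousOn r (Ioo (A.time γ ρb n) (A.time γ ρb (n + 1))) ∧
    ∀ t ∈ Ioo (A.time γ ρb n) (A.time γ ρb (n + 1)),
      Tendsto (fun y => A.u y t) (𝓝[>] A.front n i t) (𝓝 (r t))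
  time_limit : ∀ n, A.time γ ρb (n + 1) ≤ T →
    ∀ᵐ x, ∃ l, Tendsto (A.u x) (𝓝[<] A.time γ ρb (n + 1)) (𝓝 l)

/-- The entropy condition for the discontinuities of `u`, up to an error `e`: in every strip the
production at the discontinuities to the right of any point is at least `-e`. For admissible shocks
the production is nonnegative; the error leaves room for rarefaction fans. -/
def EntropyCondition (T e : ℝ) : Prop :=
  ∀ n, A.time γ ρb (n + 1) ≤ T → ∀ a : ℝ, -e ≤ A.production γ ρb n (Ici a)

/-- The bounds for the Riemann invariants of `u(·, t_{n+1} - 0)`, up to an error `e`. They are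
required only off the vacuum, where the Riemann invariants are meaningful. -/
def RiemannBounds (T e : ℝ) : Prop :=
  ∀ n, A.time γ ρb (n + 1) ≤ T → ∀ j : ℤ, Even j →
    ∀ᵐ x, x ∈ Ico (A.node (j - 1)) (A.node (j + 1)) → 0 < (A.before γ ρb (n + 1) x).1 →
      -A.boundM γ ρb ε δ (n + 1) - A.initEnergy γ ρb - A.functionalL γ ρb n
          + (∫ y in Iic x, relEnergy γ ρb (A.before γ ρb (n + 1) y)) - e
        ≤ riemannZ γ (A.before γ ρb (n + 1) x) ∧
      riemannW γ (A.before γ ρb (n + 1) x)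
        ≤ A.boundM γ ρb ε δ (n + 1) + A.functionalL γ ρb n
          + (∫ y in Iic x, relEnergy γ ρb (A.before γ ρb (n + 1) y))
          + A.production γ ρb n (Iio (A.node (j + 1))) + e

end Approx

end IsentropicGas

end

/-!
The averages inherit the bounds for the Riemann invariants because a region `w ≤ C` is convex in
`(ρ, m)`: it is `m ≤ C ρ - ρ ^ (1 + θ) / θ`. Here the bound is not constant but grows with the
relative energy `∫_{-∞}^x J` to the left, and it varies by `O(Δx)` in a cell, while an error `o(Δx)`
is all that is allowed.

What saves the argument is strict convexity (`rpow_bregman_lower`, `mean_invariant_le_of_small`).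
On one cell, with means `r` of `ρ` and `M` of `m`, all errors of size `Δx` come multiplied with the
mean oscillation of `ρ` or of `m`. The Bregman distance of `ρ ↦ ρ ^ (1 + θ)` controls
`λ |ρ - r|` up to `O(λ² r ^ (1 - θ))`, and `m` differs from a function of `ρ` by the slack in the
bound for `w`, which averaging turns into a gain of the same size divided by `r`. With `λ = O(Δx)`
and after division by `r` there remains `O(Δx² r ^ (-θ)) = O(Δx ^ (2 - μ θ))`, as `r ≥ Δx ^ μ`, and
this is `o(Δx)`. The bound for `z` is that for `w` of the reflected state `(ρ, -m)`.

The rest is bookkeeping of the energy. By Taylor's formula about the mean state (`taylor_energy`),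
the mean over a cell of the energy to the left of `x` is the energy of the mean state to the left of
the midpoint, plus the mean of the integrated Taylor remainders, plus first order terms which are
again `Δx` times the oscillation (`IsProfile.abs_mean_leftEnergy_sub_le`). The remainders, the
energy lost by averaging in the cells to the left (`IsProfile.leftEnergy_loss`; the mass of a cell is
preserved), and the entropy production are the three parts of `L_n - L_{n-1}`. The parts that are
left over belong to other cells or to fronts further to the right; they are nonnegative by convexity
of the energy, and at least `-ω(Δx)` by the entropy condition. Splitting the production at a point
requires its integrability in time, which follows from the continuity of the traces along the fronts
(`Approx.intervalIntegrable_productionRate`). At `n = 0` the bounds before averaging are the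
definition of `M_0`.
-/

noncomputable section

namespace IsentropicGas

/-! ### Strict convexity of a power function -/

/-- The tangent line of the convex function `ρ ↦ ρ ^ (1 + θ)` at `t` lies below its graph. -/
lemma rpow_one_add_tangent_le {θ ρ t : ℝ} (hθ : 0 < θ) (hρ : 0 ≤ ρ) (ht : 0 ≤ t) :
    t ^ (1 + θ) + (1 + θ) * t ^ θ * (ρ - t) ≤ ρ ^ (1 + θ) := by
  rcases ht.eq_or_lt with rfl | ht
  · rw [Real.zero_rpow (by positivity), Real.zero_rpow hθ.ne']
    simpa using Real.rpow_nonneg hρ _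
  have h := one_add_mul_self_le_rpow_one_add (s := ρ / t - 1) (p := 1 + θ)
    (by linarith [div_nonneg hρ ht.le]) (by linarith)
  have h2 : (1 + (ρ / t - 1)) ^ (1 + θ) = ρ ^ (1 + θ) / t ^ (1 + θ) := by
    rw [← Real.div_rpow hρ ht.le]; congr 1; ring
  have h3 : t ^ (1 + θ) = t * t ^ θ := by rw [Real.rpow_add ht, Real.rpow_one]
  have hp : 0 < t ^ (1 + θ) := Real.rpow_pos_of_pos ht _
  rw [h2, le_div_iff₀ hp] at h
  refine le_trans (le_of_eq ?_) h
  rw [h3]; field_simp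

lemma one_add_half_mul_le_rpow {θ y : ℝ} (hθ : 0 < θ) (hθ1 : θ ≤ 1) (hy : 0 ≤ y) (hy1 : y ≤ 1) :
    1 + θ / 2 * y ≤ (1 + y) ^ θ := by
  have hpos : 0 < 1 + y := by linarith
  -- Bernoulli's inequality for the reciprocal `(1 + y)⁻¹ = 1 - y / (1 + y)`
  have h := rpow_one_add_le_one_add_mul_self (s := -(y / (1 + y))) (p := θ)
    (by rw [neg_le_neg_iff, div_le_one hpos]; linarith) hθ.le hθ1
  have h2 : 1 + -(y / (1 + y)) = (1 + y)⁻¹ := by field_simp; ring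
  rw [h2, Real.inv_rpow hpos.le] at h
  have hw : 0 < (1 + y) ^ θ := Real.rpow_pos_of_pos hpos _
  have h4 : y / 2 ≤ y / (1 + y) := by gcongr; linarith
  set q := y / (1 + y)
  have h5 : ((1 + y) ^ θ)⁻¹ ≤ 1 - θ / 2 * y := by nlinarith
  have h6 : 1 ≤ (1 - θ / 2 * y) * (1 + y) ^ θ := by
    have := mul_le_mul_of_nonneg_right h5 hw.le
    rwa [inv_mul_cancel₀ hw.ne'] at this
  have h8 : 0 < 1 - θ / 2 * y := by nlinarith
  by_contra! hc
  nlinarith [sq_nonneg (θ / 2 * y)]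

/-- Quantitative strict convexity of `ρ ↦ ρ ^ (1 + θ)`: its Bregman distance from `r` grows at
least linearly away from `r`, with a slope proportional to the free parameter `y`. -/
lemma rpow_bregman_lower {θ ρ r y : ℝ} (hθ : 0 < θ) (hθ1 : θ ≤ 1) (hρ : 0 ≤ ρ) (hr : 0 < r)
    (hy : 0 ≤ y) (hy1 : y ≤ 1) :
    θ / 2 * r ^ θ * y * (|ρ - r| - r * y)
      ≤ ρ ^ (1 + θ) - r ^ (1 + θ) - (1 + θ) * r ^ θ * (ρ - r) := by
  have hrθ : 0 < r ^ θ := Real.rpow_pos_of_pos hr _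
  -- the tangent lines at `r` and at `t` give a lower bound that vanishes at `t`
  have key : ∀ t, 0 ≤ t → (1 + θ) * (t ^ θ - r ^ θ) * (ρ - t)
      ≤ ρ ^ (1 + θ) - r ^ (1 + θ) - (1 + θ) * r ^ θ * (ρ - r) := by
    intro t ht
    have h1 := rpow_one_add_tangent_le hθ hρ ht
    have h2 := rpow_one_add_tangent_le hθ ht hr.le
    nlinarith
  have h0 := rpow_one_add_tangent_le hθ hρ hr.le
  by_cases hc : |ρ - r| ≤ r * y
  · have : θ / 2 * r ^ θ * y * (|ρ - r| - r * y) ≤ 0 :=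
      mul_nonpos_of_nonneg_of_nonpos (by positivity) (by linarith)
    linarith
  push Not at hc
  rcases le_total r ρ with h | h
  · rw [abs_of_nonneg (by linarith)] at hc ⊢
    have ht := key (r * (1 + y)) (by positivity)
    rw [Real.mul_rpow hr.le (by linarith)] at ht
    have hb := one_add_half_mul_le_rpow hθ hθ1 hy hy1
    have h1 : θ / 2 * r ^ θ * y ≤ (1 + θ) * (r ^ θ * (1 + y) ^ θ - r ^ θ) := by
      have : r ^ θ * (θ / 2 * y) ≤ r ^ θ * ((1 + y) ^ θ - 1) := by gcongr; linarith
      have h0 : 0 ≤ r ^ θ * (θ / 2 * y) := by positivity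
      nlinarith
    have := mul_le_mul_of_nonneg_right h1 (show 0 ≤ ρ - r * (1 + y) by linarith)
    linarith [show ρ - r * (1 + y) = ρ - r - r * y by ring]
  · rw [abs_of_nonpos (by linarith)] at hc ⊢
    have ht := key (r * (1 - y)) (mul_nonneg hr.le (by linarith))
    rw [Real.mul_rpow hr.le (by linarith)] at ht
    have hb := rpow_one_add_le_one_add_mul_self (s := -y) (p := θ) (by linarith) hθ.le hθ1
    rw [← sub_eq_add_neg] at hb
    have h1 : θ / 2 * r ^ θ * y ≤ (1 + θ) * (r ^ θ - r ^ θ * (1 - y) ^ θ) := by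
      have : r ^ θ * (θ * y) ≤ r ^ θ * (1 - (1 - y) ^ θ) := by gcongr; linarith
      have h0 : 0 ≤ r ^ θ * (θ * y) := by positivity
      nlinarith
    have := mul_le_mul_of_nonneg_right h1 (show 0 ≤ r * (1 - y) - ρ by linarith)
    linarith [show r * (1 - y) - ρ = -(ρ - r) - r * y by ring]

lemma abs_rpow_one_add_sub_le {θ ρ r B : ℝ} (hθ : 0 < θ) (hρ : 0 ≤ ρ) (hρB : ρ ≤ B) (hr : 0 ≤ r)
    (hrB : r ≤ B) : |ρ ^ (1 + θ) - r ^ (1 + θ)| ≤ (1 + θ) * B ^ θ * |ρ - r| := by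
  have aux : ∀ {a b : ℝ}, 0 ≤ a → 0 ≤ b → b ≤ B →
      b ^ (1 + θ) - a ^ (1 + θ) ≤ (1 + θ) * B ^ θ * |a - b| := by
    intro a b ha hb hbB
    have h1 := rpow_one_add_tangent_le hθ ha hb
    have h2 : b ^ θ ≤ B ^ θ := Real.rpow_le_rpow hb hbB hθ.le
    have h3 : (1 + θ) * b ^ θ * (b - a) ≤ (1 + θ) * b ^ θ * |a - b| := by
      have : b - a ≤ |a - b| := by rw [abs_sub_comm]; exact le_abs_self _
      have h0 : 0 ≤ b ^ θ := Real.rpow_nonneg hb _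
      gcongr
    have h4 : (1 + θ) * b ^ θ * |a - b| ≤ (1 + θ) * B ^ θ * |a - b| := by gcongr
    linarith
  rw [abs_le]
  have h1 := aux hρ hr hrB
  have h2 := aux hr hρ hρB
  rw [abs_sub_comm] at h2
  constructor <;> linarith

/-! ### Pointwise properties of the energy -/

/-- The states with density in `[0, B]` and velocity at most `B` in absolute value. -/
def Cone (B : ℝ) : Set (ℝ × ℝ) := {u | 0 ≤ u.1 ∧ u.1 ≤ B ∧ |u.2| ≤ B * u.1}

lemma isClosed_cone (B : ℝ) : IsClosed (Cone B) := by
  have h1 : IsClosed {u : ℝ × ℝ | 0 ≤ u.1} := isClosed_le continuous_const continuous_fst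
  have h2 : IsClosed {u : ℝ × ℝ | u.1 ≤ B} := isClosed_le continuous_fst continuous_const
  have h3 : IsClosed {u : ℝ × ℝ | |u.2| ≤ B * u.1} :=
    isClosed_le continuous_snd.abs (continuous_const.mul continuous_fst)
  exact h1.inter (h2.inter h3)

lemma eq_zero_of_mem_cone {B : ℝ} {u : ℝ × ℝ} (h : u ∈ Cone B) (h0 : u.1 = 0) : u = 0 := by
  have := h.2.2
  rw [h0, mul_zero, abs_nonpos_iff] at this
  exact Prod.ext h0 this

lemma cone_velocity_le {B : ℝ} (hB : 0 ≤ B) {u : ℝ × ℝ} (h : u ∈ Cone B) :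
    |u.2 / u.1| ≤ B := by
  rcases h.1.eq_or_lt with h0 | h0
  · simp [← h0, hB]
  · rw [abs_div, abs_of_pos h0, div_le_iff₀ h0]; exact h.2.2

lemma cone_momentum_le {B : ℝ} (hB : 0 ≤ B) {u : ℝ × ℝ} (h : u ∈ Cone B) : |u.2| ≤ B * B :=
  h.2.2.trans (mul_le_mul_of_nonneg_left h.2.1 hB)

lemma measurable_energy (γ : ℝ) : Measurable (energy γ) := by
  unfold energy; fun_prop

lemma measurable_energyFlux (γ : ℝ) : Measurable (energyFlux γ) := by
  unfold energyFlux; fun_prop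

lemma measurable_relEnergy (γ ρb : ℝ) : Measurable (relEnergy γ ρb) := by
  have := measurable_energy γ
  unfold relEnergy; fun_prop

lemma abs_energy_le {γ B : ℝ} (hγ : 1 < γ) (hB : 0 ≤ B) {u : ℝ × ℝ} (h : u ∈ Cone B) :
    |energy γ u| ≤ B ^ 3 + 1 / (γ * (γ - 1)) * B ^ γ := by
  have hv := cone_velocity_le hB h
  have hm := cone_momentum_le hB h
  have hγ1 : 0 < γ - 1 := by linarith
  have h1 : 0 ≤ u.2 ^ 2 / u.1 := div_nonneg (sq_nonneg _) h.1
  have h2 : u.2 ^ 2 / u.1 ≤ B * (B * B) := by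
    calc u.2 ^ 2 / u.1 ≤ |u.2 ^ 2 / u.1| := le_abs_self _
      _ = |u.2 / u.1| * |u.2| := by rw [← abs_mul]; congr 1; ring
      _ ≤ _ := by gcongr
  have h3 : 0 ≤ u.1 ^ γ := Real.rpow_nonneg h.1 _
  have h4 : u.1 ^ γ ≤ B ^ γ := Real.rpow_le_rpow h.1 h.2.1 (by linarith)
  have h5 : 1 / (γ * (γ - 1)) * u.1 ^ γ ≤ 1 / (γ * (γ - 1)) * B ^ γ := by gcongr
  have h6 : 0 ≤ 1 / (γ * (γ - 1)) * u.1 ^ γ := by positivity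
  unfold energy
  rw [abs_le]; constructor <;> nlinarith

lemma abs_energyFlux_le {γ B : ℝ} (hγ : 1 < γ) (hB : 0 ≤ B) {u : ℝ × ℝ} (h : u ∈ Cone B) :
    |energyFlux γ u| ≤ B * B * (1 / 2 * B ^ 2 + B ^ (γ - 1) / (γ - 1)) := by
  have hv := cone_velocity_le hB h
  have hm := cone_momentum_le hB h
  have hγ1 : 0 < γ - 1 := by linarith
  have h2 : u.2 ^ 2 / u.1 ^ 2 ≤ B ^ 2 := by
    rw [← div_pow, ← sq_abs]; gcongr
  have h3 : 0 ≤ u.1 ^ (γ - 1) := Real.rpow_nonneg h.1 _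
  have h4 : u.1 ^ (γ - 1) ≤ B ^ (γ - 1) := Real.rpow_le_rpow h.1 h.2.1 (by linarith)
  unfold energyFlux
  rw [abs_mul, abs_of_nonneg (a := 1 / 2 * (u.2 ^ 2 / u.1 ^ 2) + _) (by positivity)]
  gcongr

/-- The relative energy is nonnegative, as `ρ ^ γ` lies above its tangent line at `ρb`. -/
lemma relEnergy_nonneg {γ ρb : ℝ} (hγ : 1 < γ) (hρb : 0 < ρb) {u : ℝ × ℝ} (h : 0 ≤ u.1) :
    0 ≤ relEnergy γ ρb u := by
  have h1 : 0 ≤ u.2 ^ 2 / u.1 := div_nonneg (sq_nonneg _) h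
  have hγ1 : 0 < γ - 1 := by linarith
  have h2 := rpow_one_add_tangent_le hγ1 h hρb.le
  rw [add_sub_cancel] at h2
  have h3 : ρb ^ γ = ρb * ρb ^ (γ - 1) := by
    rw [← Real.rpow_one_add' hρb.le (by linarith)]; congr 1; ring
  have h4 : energy γ u - ρb ^ (γ - 1) / (γ - 1) * u.1 + ρb ^ γ / γ
      = 1 / 2 * (u.2 ^ 2 / u.1) +
        (u.1 ^ γ - (ρb ^ γ + γ * ρb ^ (γ - 1) * (u.1 - ρb))) / (γ * (γ - 1)) := by
    unfold energy; rw [h3]; field_simp; ring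
  unfold relEnergy
  rw [h4]
  have : 0 ≤ (u.1 ^ γ - (ρb ^ γ + γ * ρb ^ (γ - 1) * (u.1 - ρb))) / (γ * (γ - 1)) :=
    div_nonneg (by linarith) (by positivity)
  linarith

lemma relEnergy_far {γ ρb : ℝ} (hγ : 1 < γ) (hρb : 0 < ρb) : relEnergy γ ρb (ρb, 0) = 0 := by
  have hγ1 : γ - 1 ≠ 0 := by linarith
  have h3 : ρb ^ γ = ρb * ρb ^ (γ - 1) := by
    rw [← Real.rpow_one_add' hρb.le (by linarith)]; congr 1; ring
  simp only [relEnergy, energy]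
  rw [h3]; field_simp; ring

/-- A bound of the relative energy on the cone. -/
def relEnergyBound (γ ρb B : ℝ) : ℝ :=
  B ^ 3 + 1 / (γ * (γ - 1)) * B ^ γ + ρb ^ γ / γ

lemma relEnergyBound_nonneg {γ ρb B : ℝ} (hγ : 1 < γ) (hρb : 0 < ρb) (hB : 0 ≤ B) :
    0 ≤ relEnergyBound γ ρb B := by
  have hγ1 : 0 < γ - 1 := by linarith
  unfold relEnergyBound; positivity

lemma relEnergy_le {γ ρb B : ℝ} (hγ : 1 < γ) (hρb : 0 < ρb) (hB : 0 ≤ B) {u : ℝ × ℝ}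
    (h : u ∈ Cone B) : relEnergy γ ρb u ≤ relEnergyBound γ ρb B := by
  have h1 := (le_abs_self _).trans (abs_energy_le hγ hB h)
  have hγ1 : 0 < γ - 1 := by linarith
  have h2 : 0 ≤ ρb ^ (γ - 1) / (γ - 1) * u.1 := mul_nonneg (by positivity) h.1
  unfold relEnergy relEnergyBound; linarith

/-! ### Taylor expansion of the energy -/

/-- The differential of the mechanical energy at the state `E`, applied to `d`. -/
def energyGrad (γ : ℝ) (E d : ℝ × ℝ) : ℝ :=
  (E.1 ^ (γ - 1) / (γ - 1) - 1 / 2 * (E.2 / E.1) ^ 2) * d.1 + E.2 / E.1 * d.2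

lemma energyHess_nonneg {γ : ℝ} {u d : ℝ × ℝ} (hu : 0 ≤ u.1) : 0 ≤ energyHess γ u d := by
  rcases hu.eq_or_lt with h | h
  · simp only [energyHess, ← h]
    simp only [ne_eq, OfNat.ofNat_ne_zero, not_false_eq_true, zero_pow, div_zero, zero_add,
      zero_mul, mul_zero, sub_zero, add_zero]
    exact mul_nonneg (Real.rpow_nonneg le_rfl _) (sq_nonneg _)
  have : energyHess γ u d = u.1 ^ (γ - 2) * d.1 ^ 2 + (u.2 / u.1 * d.1 - d.2) ^ 2 / u.1 := by
    unfold energyHess; field_simp; ring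
  rw [this]; positivity

lemma taylorRemainder_nonneg {γ : ℝ} {E u : ℝ × ℝ} (hE : 0 ≤ E.1) (hu : 0 ≤ u.1) :
    0 ≤ taylorRemainder γ E u := by
  unfold taylorRemainder
  apply intervalIntegral.integral_nonneg zero_le_one
  intro τ hτ
  refine mul_nonneg (by linarith [hτ.2]) (energyHess_nonneg ?_)
  have : (E + τ • (u - E)).1 = (1 - τ) * E.1 + τ * u.1 := by simp; ring
  rw [this]
  exact add_nonneg (mul_nonneg (by linarith [hτ.2]) hE) (mul_nonneg hτ.1 hu)

lemma hasDerivAt_energy_line {γ : ℝ} (hγ : 1 < γ) (E d : ℝ × ℝ) {τ : ℝ} (h : 0 < E.1 + τ * d.1) :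
    HasDerivAt (fun τ : ℝ => energy γ (E + τ • d)) (energyGrad γ (E + τ • d) d) τ := by
  have h1 : HasDerivAt (fun τ : ℝ => E.1 + τ * d.1) d.1 τ := by
    simpa using ((hasDerivAt_id τ).mul_const d.1).const_add E.1
  have h2 : HasDerivAt (fun τ : ℝ => E.2 + τ * d.2) d.2 τ := by
    simpa using ((hasDerivAt_id τ).mul_const d.2).const_add E.2
  have h3 := h1.rpow_const (p := γ) (Or.inl h.ne')
  have h4 := (((h2.pow 2).div h1 h.ne').const_mul (1 / 2)).add
    (h3.const_mul (1 / (γ * (γ - 1))))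
  simp only [energy, energyGrad, Prod.fst_add, Prod.snd_add, Prod.smul_fst, Prod.smul_snd,
    smul_eq_mul]
  have hγ1 : γ - 1 ≠ 0 := by linarith
  have hp := h.ne'
  refine h4.congr_deriv ?_
  simp only [Pi.pow_apply]
  field_simp
  ring

lemma hasDerivAt_energyGrad_line {γ : ℝ} (hγ : 1 < γ) (E d : ℝ × ℝ) {τ : ℝ}
    (h : 0 < E.1 + τ * d.1) :
    HasDerivAt (fun τ : ℝ => energyGrad γ (E + τ • d) d) (energyHess γ (E + τ • d) d) τ := by
  have h1 : HasDerivAt (fun τ : ℝ => E.1 + τ * d.1) d.1 τ := by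
    simpa using ((hasDerivAt_id τ).mul_const d.1).const_add E.1
  have h2 : HasDerivAt (fun τ : ℝ => E.2 + τ * d.2) d.2 τ := by
    simpa using ((hasDerivAt_id τ).mul_const d.2).const_add E.2
  have h3 := h1.rpow_const (p := γ - 1) (Or.inl h.ne')
  have h4 := h2.div h1 h.ne'
  have h5 := (((h3.div_const (γ - 1)).sub ((h4.pow 2).const_mul (1 / 2))).mul_const d.1).add
    (h4.mul_const d.2)
  simp only [energyHess, energyGrad, Prod.fst_add, Prod.snd_add, Prod.smul_fst, Prod.smul_snd,
    smul_eq_mul]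
  have hγ1 : γ - 1 ≠ 0 := by linarith
  have hp := h.ne'
  have e : γ - 1 - 1 = γ - 2 := by ring
  rw [e] at h5
  refine h5.congr_deriv ?_
  simp only [Pi.div_apply, Nat.cast_ofNat, Nat.add_one_sub_one, pow_one]
  generalize E.1 + τ * d.1 = p at hp ⊢
  generalize E.2 + τ * d.2 = q
  field_simp
  ring

/-- Taylor's formula with integral remainder; it holds up to the vacuum state. -/
lemma taylor_energy {γ B : ℝ} (hγ : 1 < γ) {E u : ℝ × ℝ} (hE : 0 < E.1) (hu : u ∈ Cone B) :
    taylorRemainder γ E u = energy γ u - energy γ E - energyGrad γ E (u - E) := by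
  have hγ1 : 0 < γ - 1 := by linarith
  rcases hu.1.eq_or_lt with h0 | h0
  · -- towards the vacuum the integrand is `(1 - τ) ^ (γ - 1) * E.1 ^ γ`
    have hz : u = 0 := eq_zero_of_mem_cone hu h0.symm
    subst hz
    have e2 : E.1 ^ γ = E.1 ^ (γ - 2) * E.1 ^ 2 := by
      rw [← Real.rpow_natCast E.1 2, ← Real.rpow_add hE]; congr 1; norm_num
    have e3 : E.1 ^ γ = E.1 * E.1 ^ (γ - 1) := by
      rw [← Real.rpow_one_add' hE.le (by linarith)]; congr 1; ring
    have h1 : taylorRemainder γ E 0 = ∫ τ in (0 : ℝ)..1, (1 - τ) ^ (γ - 1) * E.1 ^ γ := by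
      unfold taylorRemainder
      apply intervalIntegral.integral_congr
      intro τ hτ
      rw [uIcc_of_le zero_le_one] at hτ
      rcases hτ.2.eq_or_lt with h | h
      · simp [h, Real.zero_rpow hγ1.ne']
      have hs : 0 < 1 - τ := by linarith
      have e1 : E + τ • (0 - E) = ((1 - τ) * E.1, (1 - τ) * E.2) := by
        ext <;> simp <;> ring
      have e4 : (1 - τ) ^ (γ - 1) = (1 - τ) * (1 - τ) ^ (γ - 2) := by
        rw [← Real.rpow_one_add' hs.le (by linarith)]; congr 1; ring
      simp only [e1, energyHess, Prod.fst_sub, Prod.snd_sub, Prod.fst_zero, Prod.snd_zero]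
      rw [Real.mul_rpow hs.le hE.le, e2, e4]
      field_simp
      ring
    rw [h1, intervalIntegral.integral_mul_const]
    have h2 : ∫ τ in (0 : ℝ)..1, (1 - τ) ^ (γ - 1) = 1 / γ := by
      rw [intervalIntegral.integral_comp_sub_left (fun x => x ^ (γ - 1)) 1, sub_self, sub_zero,
        integral_rpow (Or.inl (by linarith))]
      simp [Real.zero_rpow (show γ ≠ 0 by linarith)]
    rw [h2]
    simp only [energy, energyGrad, Prod.fst_sub, Prod.snd_sub, Prod.fst_zero, Prod.snd_zero]
    rw [Real.zero_rpow (show γ ≠ 0 by linarith), e3]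
    field_simp
    ring
  · have hpos : ∀ τ ∈ Icc (0 : ℝ) 1, 0 < E.1 + τ * (u - E).1 := by
      intro τ hτ
      have : E.1 + τ * (u - E).1 = (1 - τ) * E.1 + τ * u.1 := by simp; ring
      rw [this]
      rcases hτ.2.eq_or_lt with h | h
      · simpa [h] using h0
      · exact add_pos_of_pos_of_nonneg (mul_pos (by linarith) hE) (mul_nonneg hτ.1 h0.le)
    set d := u - E with hd
    have hder : ∀ τ ∈ Icc (0 : ℝ) 1, HasDerivAt
        (fun τ => (1 - τ) * energyGrad γ (E + τ • d) d + energy γ (E + τ • d))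
        ((1 - τ) * energyHess γ (E + τ • d) d) τ := by
      intro τ hτ
      have h1 := hasDerivAt_energy_line hγ E d (hpos τ hτ)
      have h2 := hasDerivAt_energyGrad_line hγ E d (hpos τ hτ)
      have h3 := (((hasDerivAt_id τ).const_sub 1).mul h2).add h1
      refine h3.congr_deriv ?_
      simp only [id]; ring
    have hint : IntervalIntegrable (fun τ => (1 - τ) * energyHess γ (E + τ • d) d) volume 0 1 := by
      apply intervalIntegral.intervalIntegrable_deriv_of_nonneg
        (fun τ hτ =>
          (hder τ (by rwa [uIcc_of_le zero_le_one] at hτ)).continuousAt.continuousWithinAt)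
      · intro τ hτ
        rw [min_eq_left zero_le_one, max_eq_right zero_le_one] at hτ
        exact hder τ (Ioo_subset_Icc_self hτ)
      · intro τ hτ
        rw [min_eq_left zero_le_one, max_eq_right zero_le_one] at hτ
        refine mul_nonneg (by linarith [hτ.2]) (energyHess_nonneg ?_)
        simpa using (hpos τ (Ioo_subset_Icc_self hτ)).le
    have := intervalIntegral.integral_eq_sub_of_hasDerivAt
      (fun τ hτ => hder τ (by rwa [uIcc_of_le zero_le_one] at hτ)) hint
    unfold taylorRemainder
    rw [← hd, this]
    have e : E + d = u := by rw [hd]; abel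
    simp only [one_smul, zero_smul, add_zero, e]
    ring

lemma taylorRemainder_self (γ : ℝ) (E : ℝ × ℝ) : taylorRemainder γ E E = 0 := by
  simp [taylorRemainder, energyHess]

/-! ### Riemann invariants of averages -/

lemma integrable_of_ae_abs_le {ν : Measure ℝ} [IsFiniteMeasure ν] {f : ℝ → ℝ}
    (hf : AEMeasurable f ν) {K : ℝ} (h : ∀ᵐ x ∂ν, |f x| ≤ K) : Integrable f ν :=
  Integrable.of_bound hf.aestronglyMeasurable K (by simpa using h)

lemma integral_abs_sub_integral_le {ν : Measure ℝ} [IsProbabilityMeasure ν] {m : ℝ → ℝ}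
    (hm : Integrable m ν) (c : ℝ) :
    ∫ x, |m x - ∫ y, m y ∂ν| ∂ν ≤ 2 * ∫ x, |m x - c| ∂ν := by
  set M := ∫ y, m y ∂ν with hM
  have hc : Integrable (fun x => |m x - c|) ν := (hm.sub (integrable_const c)).abs
  have h1 : |M - c| ≤ ∫ x, |m x - c| ∂ν := by
    have : M - c = ∫ x, (m x - c) ∂ν := by
      rw [integral_sub hm (integrable_const c)]; simp [hM]
    rw [this]; exact abs_integral_le_integral_abs
  have h2 : ∫ x, |m x - M| ∂ν ≤ ∫ x, (|m x - c| + |M - c|) ∂ν := by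
    apply integral_mono (hm.sub (integrable_const M)).abs (hc.add (integrable_const _))
    intro x
    have := abs_sub_le (m x) c M
    rw [abs_sub_comm c M] at this
    exact this
  rw [integral_add hc (integrable_const _)] at h2
  simp at h2
  linarith

/-- The largest value of `|m| / ρ + ρ ^ θ / θ` on the cone. -/
def invariantBound (θ B : ℝ) : ℝ := B + B ^ θ / θ

/-- The constant in front of the linear error terms in `mean_invariant_le_of_small`. -/
def meanConst (θ B K K₁ : ℝ) : ℝ :=
  K + B * K₁ + 2 * B ^ 2 * (invariantBound θ B + 2 * K + (1 + θ) * B ^ θ / θ)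

/-- The inequality of `mean_invariant_le_of_small` before integration, at a single state `(ρ, m)`,
with mean density `r`. The Bregman distance of `ρ` from `r` absorbs what is linear in `|ρ - r|`, and
the slack `(C + g) * ρ - ρ ^ (1 + θ) / θ - m` absorbs the deviation of `m` that is not controlled by
`|ρ - r|`. -/
lemma state_defect_le {θ B K K₁ H C ρ m g r : ℝ} (hθ : 0 < θ) (hθ1 : θ ≤ 1) (hB : 0 < B)
    (hK : 0 ≤ K) (hK₁ : 0 ≤ K₁) (hH : 0 < H) (hHB : 2 * B * B * H ≤ 1)
    (hρ0 : 0 ≤ ρ) (hρB : ρ ≤ B) (hr : 0 < r) (hrB : r ≤ B) (hgx : |g| ≤ H * K)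
    (hx : m ≤ (C + g) * ρ - ρ ^ (1 + θ) / θ) (hCW : |C| ≤ invariantBound θ B + 2 * K)
    (hsmall : 2 * H * meanConst θ B K K₁ ≤ r ^ θ) :
    m + (r ^ (1 + θ) / θ + (1 + θ) * r ^ θ / θ * (ρ - r)
      + r * H * (K₁ * |ρ - r| + 2 * B * |m - (C * r - r ^ (1 + θ) / θ)|))
      ≤ C * ρ + (r * g + (r * (2 * (H * meanConst θ B K K₁) ^ 2 / r ^ θ)
        + 2 * r * H ^ 2 * B * K * ρ)) := by
  set W := invariantBound θ B with hW
  set K₃ := meanConst θ B K K₁ with hK₃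
  have hBθ : 0 < B ^ θ := Real.rpow_pos_of_pos hB _
  have hrθ : 0 < r ^ θ := Real.rpow_pos_of_pos hr _
  have hW0 : 0 < W := by rw [hW, invariantBound]; positivity
  have hK₃0 : 0 < K₃ := by rw [hK₃, meanConst, ← hW]; positivity
  set c := C * r - r ^ (1 + θ) / θ with hc
  -- with this `y` the Bregman bound, divided by `θ`, has the slope `H * K₃` in `|ρ - r|`
  set y := 2 * H * K₃ / r ^ θ with hy
  have hy0 : 0 ≤ y := by positivity
  have hy1 : y ≤ 1 := by rw [hy, div_le_one hrθ]; exact hsmall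
  set X := 2 * (H * K₃) ^ 2 / r ^ θ with hX
  set s := (C + g) * ρ - ρ ^ (1 + θ) / θ - m with hs
  have hs0 : 0 ≤ s := by linarith
  set a := |ρ - r| with ha
  have ha0 : 0 ≤ a := abs_nonneg _
  have hD := rpow_bregman_lower (y := y) hθ hθ1 hρ0 hr hy0 hy1
  rw [← ha] at hD
  have hD1 : H * K₃ * a - r * X
      ≤ (ρ ^ (1 + θ) - r ^ (1 + θ) - (1 + θ) * r ^ θ * (ρ - r)) / θ := by
    rw [le_div_iff₀ hθ]
    refine le_trans (le_of_eq ?_) hD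
    rw [hX, hy]; field_simp
  have hp := abs_rpow_one_add_sub_le hθ hρ0 hρB hr.le hrB
  rw [← ha] at hp
  have hmc : |m - c| ≤ (W + 2 * K + (1 + θ) * B ^ θ / θ) * a + H * K * ρ + s := by
    have e : m - c = C * (ρ - r) + g * ρ - (ρ ^ (1 + θ) - r ^ (1 + θ)) / θ - s := by
      rw [hs, hc]; ring
    have h1 : |C * (ρ - r)| ≤ (W + 2 * K) * a := by rw [abs_mul]; gcongr
    have h2 : |g * ρ| ≤ H * K * ρ := by
      rw [abs_mul, abs_of_nonneg hρ0]; gcongr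
    have h3 : |(ρ ^ (1 + θ) - r ^ (1 + θ)) / θ| ≤ (1 + θ) * B ^ θ / θ * a := by
      rw [abs_div, abs_of_pos hθ, div_mul_eq_mul_div]; gcongr
    rw [e]
    rw [abs_le] at h1 h2 h3 ⊢
    constructor <;> linarith [h1.1, h1.2, h2.1, h2.2, h3.1, h3.2]
  have hga : g * (ρ - r) ≤ H * K * a := by
    refine (le_abs_self _).trans ?_
    rw [abs_mul]; gcongr
  have hrH : r * H ≤ B * H := by gcongr
  have h2rHB : 2 * r * H * B ≤ 1 := by nlinarith
  have t1 : r * H * (K₁ * a) ≤ H * (B * K₁) * a := by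
    have := mul_le_mul_of_nonneg_right hrH (show 0 ≤ K₁ * a by positivity)
    linarith
  have t2 : r * H * (2 * B * |m - c|)
      ≤ H * (2 * B ^ 2 * (W + 2 * K + (1 + θ) * B ^ θ / θ)) * a
        + 2 * r * H ^ 2 * B * K * ρ + s := by
    set Q := W + 2 * K + (1 + θ) * B ^ θ / θ with hQ
    have hQ0 : 0 ≤ Q := by positivity
    have u1 := mul_le_mul_of_nonneg_left hmc (show 0 ≤ 2 * r * H * B by positivity)
    have u2 := mul_le_mul_of_nonneg_right h2rHB hs0
    have u3 := mul_le_mul_of_nonneg_right hrH (show 0 ≤ 2 * B * (Q * a) by positivity)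
    linarith
  have hm' : m = (C + g) * ρ - ρ ^ (1 + θ) / θ - s := by rw [hs]; ring
  have hK₃e : H * K₃ * a = H * K * a + H * (B * K₁) * a
      + H * (2 * B ^ 2 * (W + 2 * K + (1 + θ) * B ^ θ / θ)) * a := by
    rw [hK₃, meanConst, ← hW]; ring
  have hDe : (ρ ^ (1 + θ) - r ^ (1 + θ) - (1 + θ) * r ^ θ * (ρ - r)) / θ
      = ρ ^ (1 + θ) / θ - r ^ (1 + θ) / θ - (1 + θ) * r ^ θ / θ * (ρ - r) := by ring
  rw [hDe] at hD1
  linarith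

section Mean

variable {θ B K K₁ H C : ℝ} {ν : Measure ℝ} [IsProbabilityMeasure ν] {ρ m g : ℝ → ℝ}

/-- If the second Riemann invariant of `(ρ, m)` is at most `C + g`, then that of the mean state is
at most `C` plus the mean of `g`, up to a quadratic error in the size `H` of the oscillation of
`g`. The strict convexity of `ρ ↦ ρ ^ (1 + θ)` and the slack in the assumed bound moreover leave
room, on the left, for `H` times the mean oscillation of the state. -/
lemma mean_invariant_le_of_small (hθ : 0 < θ) (hθ1 : θ ≤ 1) (hB : 0 < B) (hK : 0 ≤ K)
    (hK₁ : 0 ≤ K₁) (hH : 0 < H) (hH2 : H ≤ 2) (hHB : 2 * B * B * H ≤ 1)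
    (hρ : AEMeasurable ρ ν) (hm : AEMeasurable m ν) (hg : AEMeasurable g ν)
    (hcone : ∀ᵐ x ∂ν, (ρ x, m x) ∈ Cone B) (hgK : ∀ᵐ x ∂ν, |g x| ≤ H * K)
    (hC : ∀ᵐ x ∂ν, m x ≤ (C + g x) * ρ x - ρ x ^ (1 + θ) / θ)
    (hr : 0 < ∫ x, ρ x ∂ν) (hsmall : 2 * H * meanConst θ B K K₁ ≤ (∫ x, ρ x ∂ν) ^ θ) :
    (∫ x, m x ∂ν) / (∫ x, ρ x ∂ν) + (∫ x, ρ x ∂ν) ^ θ / θ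
        + H * (K₁ * ∫ x, |ρ x - ∫ y, ρ y ∂ν| ∂ν + B * ∫ x, |m x - ∫ y, m y ∂ν| ∂ν)
      ≤ C + ∫ x, g x ∂ν
        + (2 * (H * meanConst θ B K K₁) ^ 2 / (∫ x, ρ x ∂ν) ^ θ + 2 * B ^ 2 * H ^ 2 * K) := by
  set W := invariantBound θ B with hW
  set K₃ := meanConst θ B K K₁ with hK₃
  have hρi : Integrable ρ ν := integrable_of_ae_abs_le hρ (K := B) (by
    filter_upwards [hcone] with x hx; rw [abs_of_nonneg hx.1]; exact hx.2.1)
  have hmi : Integrable m ν := integrable_of_ae_abs_le hm (K := B * B) (by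
    filter_upwards [hcone] with x hx; exact cone_momentum_le hB.le hx)
  have hgi : Integrable g ν := integrable_of_ae_abs_le hg hgK
  have hrB : ∫ x, ρ x ∂ν ≤ B := by
    have := integral_mono_ae hρi (integrable_const B)
      (by filter_upwards [hcone] with x hx; exact hx.2.1)
    simpa using this
  set r := ∫ x, ρ x ∂ν with hrdef
  set M := ∫ x, m x ∂ν with hMdef
  have hHK : 0 ≤ H * K := by positivity
  have hBθ : 0 < B ^ θ := Real.rpow_pos_of_pos hB _
  have hrθ : 0 < r ^ θ := Real.rpow_pos_of_pos hr _
  have hr1 : r ^ (1 + θ) = r * r ^ θ := by rw [Real.rpow_add hr, Real.rpow_one]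
  have hW0 : 0 < W := by rw [hW, invariantBound]; positivity
  have hK₃0 : 0 < K₃ := by rw [hK₃, meanConst, ← hW]; positivity
  -- replace `C` by a smaller constant that is bounded in terms of the data
  set C' := min C (W + H * K) with hC'def
  have hC' : ∀ᵐ x ∂ν, m x ≤ (C' + g x) * ρ x - ρ x ^ (1 + θ) / θ := by
    filter_upwards [hC, hcone, hgK] with x hx hc hgx
    rcases min_choice C (W + H * K) with h | h
    · rwa [hC'def, h]
    · rw [hC'def, h]
      have h0 : ρ x ^ (1 + θ) = ρ x * ρ x ^ θ :=
        Real.rpow_one_add' hc.1 (by positivity)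
      have h1 : ρ x ^ θ ≤ B ^ θ := Real.rpow_le_rpow hc.1 hc.2.1 hθ.le
      have h2 : ρ x * ρ x ^ θ / θ ≤ ρ x * B ^ θ / θ := by
        have := hc.1; gcongr
      have h3 : 0 ≤ (H * K + g x) * ρ x :=
        mul_nonneg (by linarith [(abs_le.1 hgx).1]) hc.1
      have h4 : W * ρ x = B * ρ x + ρ x * B ^ θ / θ := by rw [hW, invariantBound]; ring
      have h5 := (abs_le.1 hc.2.2).2
      simp only at h5
      rw [h0]
      nlinarith
  have hC'le : C' ≤ W + H * K := min_le_right _ _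
  have hC'ge : -(B + H * K) ≤ C' := by
    have hex : ∃ᵐ x ∂ν, 0 < ρ x := by
      intro hcon
      have : r ≤ 0 := integral_nonpos_of_ae (by
        filter_upwards [hcon] with x hx; exact not_lt.1 hx)
      linarith
    obtain ⟨x, hx0, hx, hc, hgx⟩ := (hex.and_eventually (hC'.and (hcone.and hgK))).exists
    have h5 := (abs_le.1 hc.2.2).1
    simp only at h5
    have h6 : 0 ≤ ρ x ^ (1 + θ) / θ := by positivity
    have h7 : 0 ≤ (C' + g x + B) * ρ x := by nlinarith
    have h8 := nonneg_of_mul_nonneg_left h7 hx0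
    linarith [(abs_le.1 hgx).2]
  have hC'abs : |C'| ≤ W + 2 * K := by
    have : H * K ≤ 2 * K := by gcongr
    have : B ≤ W := by rw [hW, invariantBound]; linarith [div_pos hBθ hθ]
    rw [abs_le]; constructor <;> linarith
  set c := C' * r - r ^ (1 + θ) / θ with hc
  set X := 2 * (H * K₃) ^ 2 / r ^ θ with hX
  have key : ∀ᵐ x ∂ν, m x + (r ^ (1 + θ) / θ + (1 + θ) * r ^ θ / θ * (ρ x - r)
      + r * H * (K₁ * |ρ x - r| + 2 * B * |m x - c|))
      ≤ C' * ρ x + (r * g x + (r * X + 2 * r * H ^ 2 * B * K * ρ x)) := by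
    filter_upwards [hC', hcone, hgK] with x hx hcx hgx
    exact state_defect_le hθ hθ1 hB hK hK₁ hH hHB hcx.1 hcx.2.1 hr hrB hgx hx hC'abs hsmall
  have i1 : Integrable (fun x => |ρ x - r|) ν := (hρi.sub (integrable_const r)).abs
  have i2 : Integrable (fun x => |m x - c|) ν := (hmi.sub (integrable_const c)).abs
  have i3 : Integrable (fun x => ρ x - r) ν := hρi.sub (integrable_const r)
  have i4 : Integrable (fun x => K₁ * |ρ x - r| + 2 * B * |m x - c|) ν :=
    (i1.const_mul _).add (i2.const_mul _)
  have i5 : Integrable (fun x => r ^ (1 + θ) / θ + (1 + θ) * r ^ θ / θ * (ρ x - r)) ν :=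
    (integrable_const _).add (i3.const_mul _)
  have i6 : Integrable (fun x => r * X + 2 * r * H ^ 2 * B * K * ρ x) ν :=
    (integrable_const _).add (hρi.const_mul _)
  have hint := integral_mono_ae (hmi.add (i5.add (i4.const_mul (r * H))))
    ((hρi.const_mul C').add ((hgi.const_mul r).add i6)) key
  simp only [Pi.add_apply] at hint
  have i7 : Integrable (fun x => r ^ (1 + θ) / θ + (1 + θ) * r ^ θ / θ * (ρ x - r)
      + r * H * (K₁ * |ρ x - r| + 2 * B * |m x - c|)) ν := i5.add (i4.const_mul _)
  have i8 : Integrable (fun x => r * g x + (r * X + 2 * r * H ^ 2 * B * K * ρ x)) ν :=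
    (hgi.const_mul r).add i6
  rw [integral_add hmi i7, integral_add i5 (i4.const_mul _),
    integral_add (integrable_const _) (i3.const_mul _), integral_const_mul, integral_const_mul,
    integral_add (i1.const_mul _) (i2.const_mul _), integral_const_mul, integral_const_mul,
    integral_sub hρi (integrable_const _), integral_add (hρi.const_mul _) i8,
    integral_add (hgi.const_mul r) i6, integral_const_mul, integral_const_mul,
    integral_add (integrable_const _) (hρi.const_mul _), integral_const_mul] at hint
  simp only [integral_const, probReal_univ, smul_eq_mul, one_mul, integral_const_mul,
    ← hrdef, ← hMdef, sub_self, mul_zero, add_zero] at hint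
  have hosc := integral_abs_sub_integral_le hmi c
  rw [← hMdef] at hosc
  have h9 : B * ∫ x, |m x - M| ∂ν ≤ 2 * B * ∫ x, |m x - c| ∂ν := by
    have := mul_le_mul_of_nonneg_left hosc hB.le
    linarith
  have h10 : C' ≤ C := min_le_left _ _
  have h12 : 2 * r * H ^ 2 * B * K ≤ 2 * B ^ 2 * H ^ 2 * K := by
    have : r * (2 * H ^ 2 * B * K) ≤ B * (2 * H ^ 2 * B * K) := by gcongr
    linarith
  rw [← mul_le_mul_iff_right₀ hr]
  have e1 : r * (M / r + r ^ θ / θ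
      + H * (K₁ * ∫ x, |ρ x - r| ∂ν + B * ∫ x, |m x - M| ∂ν))
      = M + r ^ (1 + θ) / θ + r * H * (K₁ * ∫ x, |ρ x - r| ∂ν + B * ∫ x, |m x - M| ∂ν) := by
    rw [hr1]; field_simp
  rw [e1]
  have h13 := mul_le_mul_of_nonneg_left h9 (show 0 ≤ r * H by positivity)
  have h14 := mul_le_mul_of_nonneg_left h10 hr.le
  have h15 := mul_le_mul_of_nonneg_left h12 hr.le
  linarith

/-- The bound of `mean_invariant_le_of_small` with a linear error, for oscillations `H` of
any size. -/
lemma mean_invariant_le (hθ : 0 < θ) (hB : 0 < B) (hK : 0 ≤ K)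
    (hK₁ : 0 ≤ K₁) (hH : 0 < H)
    (hρ : AEMeasurable ρ ν) (hm : AEMeasurable m ν) (hg : AEMeasurable g ν)
    (hcone : ∀ᵐ x ∂ν, (ρ x, m x) ∈ Cone B) (hgK : ∀ᵐ x ∂ν, |g x| ≤ H * K)
    (hC : ∀ᵐ x ∂ν, m x ≤ (C + g x) * ρ x - ρ x ^ (1 + θ) / θ)
    (hr : 0 < ∫ x, ρ x ∂ν) :
    (∫ x, m x ∂ν) / (∫ x, ρ x ∂ν) + (∫ x, ρ x ∂ν) ^ θ / θ
        + H * (K₁ * ∫ x, |ρ x - ∫ y, ρ y ∂ν| ∂ν + B * ∫ x, |m x - ∫ y, m y ∂ν| ∂ν)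
      ≤ C + ∫ x, g x ∂ν + H * (2 * K + 2 * B * K₁ + 2 * B ^ 3) := by
  have hρi : Integrable ρ ν := integrable_of_ae_abs_le hρ (K := B) (by
    filter_upwards [hcone] with x hx; rw [abs_of_nonneg hx.1]; exact hx.2.1)
  have hmi : Integrable m ν := integrable_of_ae_abs_le hm (K := B * B) (by
    filter_upwards [hcone] with x hx; exact cone_momentum_le hB.le hx)
  have hgi : Integrable g ν := integrable_of_ae_abs_le hg hgK
  have hmean : ∀ {f : ℝ → ℝ} {b : ℝ}, Integrable f ν → (∀ᵐ x ∂ν, |f x| ≤ b) →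
      ∫ x, |f x - ∫ y, f y ∂ν| ∂ν ≤ 2 * b := by
    intro f b hf hb
    have h := integral_abs_sub_integral_le hf 0
    simp only [sub_zero] at h
    have h2 := integral_mono_ae hf.abs (integrable_const b) hb
    simp at h2
    linarith
  have o1 := hmean hρi (b := B) (by
    filter_upwards [hcone] with x hx; rw [abs_of_nonneg hx.1]; exact hx.2.1)
  have o2 := hmean hmi (b := B * B) (by
    filter_upwards [hcone] with x hx; exact cone_momentum_le hB.le hx)
  set r := ∫ x, ρ x ∂ν with hrdef
  set M := ∫ x, m x ∂ν with hMdef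
  have hr1 : r ^ (1 + θ) = r * r ^ θ := by rw [Real.rpow_add hr, Real.rpow_one]
  have key : ∀ᵐ x ∂ν, m x + (r ^ (1 + θ) / θ + (1 + θ) * r ^ θ / θ * (ρ x - r))
      ≤ C * ρ x + (r * g x + (H * K * r + H * K * ρ x)) := by
    filter_upwards [hC, hcone, hgK] with x hx hcx hgx
    have hD : (r ^ (1 + θ) + (1 + θ) * r ^ θ * (ρ x - r)) / θ ≤ ρ x ^ (1 + θ) / θ := by
      have := rpow_one_add_tangent_le hθ hcx.1 hr.le
      simp only at this
      gcongr
    have hDe : (r ^ (1 + θ) + (1 + θ) * r ^ θ * (ρ x - r)) / θ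
        = r ^ (1 + θ) / θ + (1 + θ) * r ^ θ / θ * (ρ x - r) := by ring
    have hga : g x * (ρ x - r) ≤ H * K * (ρ x + r) := by
      refine (le_abs_self _).trans ?_
      rw [abs_mul]
      have : |ρ x - r| ≤ ρ x + r := by
        have := hcx.1
        simp only at this
        rw [abs_le]; constructor <;> linarith
      gcongr
    rw [hDe] at hD
    linarith
  have i3 : Integrable (fun x => ρ x - r) ν := hρi.sub (integrable_const r)
  have i5 : Integrable (fun x => r ^ (1 + θ) / θ + (1 + θ) * r ^ θ / θ * (ρ x - r)) ν :=
    (integrable_const _).add (i3.const_mul _)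
  have i6 : Integrable (fun x => H * K * r + H * K * ρ x) ν :=
    (integrable_const _).add (hρi.const_mul _)
  have i8 : Integrable (fun x => r * g x + (H * K * r + H * K * ρ x)) ν :=
    (hgi.const_mul r).add i6
  have hint := integral_mono_ae (hmi.add i5) ((hρi.const_mul C).add i8) key
  simp only [Pi.add_apply] at hint
  rw [integral_add hmi i5,
    integral_add (integrable_const _) (i3.const_mul _), integral_const_mul,
    integral_sub hρi (integrable_const _), integral_add (hρi.const_mul _) i8,
    integral_add (hgi.const_mul r) i6, integral_const_mul, integral_const_mul,
    integral_add (integrable_const _) (hρi.const_mul _), integral_const_mul] at hint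
  simp only [integral_const, probReal_univ, smul_eq_mul, one_mul, integral_const_mul,
    ← hrdef, ← hMdef, sub_self, mul_zero, add_zero] at hint
  have h1 : M / r + r ^ θ / θ ≤ C + ∫ x, g x ∂ν + H * (2 * K) := by
    rw [← mul_le_mul_iff_right₀ hr]
    have e1 : r * (M / r + r ^ θ / θ) = M + r ^ (1 + θ) / θ := by
      rw [hr1]; field_simp
    rw [e1]; linarith
  have h2 : H * (K₁ * ∫ x, |ρ x - r| ∂ν + B * ∫ x, |m x - M| ∂ν)
      ≤ H * (K₁ * (2 * B) + B * (2 * (B * B))) := by gcongr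
  linarith

end Mean

/-- For means over cells of half-width `h`, and mean densities of at least `h ^ μ`, the error in the
Riemann invariant is `o(h)`: it is `O(h ^ (2 - μ θ))`. -/
lemma exists_mean_invariant_error {θ B K K₁ μ : ℝ} (hθ : 0 < θ) (hθ1 : θ ≤ 1) (hB : 0 < B)
    (hK : 0 ≤ K) (hK₁ : 0 ≤ K₁) (hμθ : μ * θ < 1) :
    ∃ Ω : ℝ → ℝ, Ω =o[𝓝[>] 0] (fun h : ℝ => h) ∧
      ∀ (h : ℝ) (ν : Measure ℝ) (ρ m g : ℝ → ℝ) (C : ℝ), 0 < h → IsProbabilityMeasure ν →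
        AEMeasurable ρ ν → AEMeasurable m ν → AEMeasurable g ν →
        (∀ᵐ x ∂ν, (ρ x, m x) ∈ Cone B) → (∀ᵐ x ∂ν, |g x| ≤ 2 * h * K) →
        (∀ᵐ x ∂ν, m x ≤ (C + g x) * ρ x - ρ x ^ (1 + θ) / θ) →
        h ^ μ ≤ ∫ x, ρ x ∂ν →
        (∫ x, m x ∂ν) / (∫ x, ρ x ∂ν) + (∫ x, ρ x ∂ν) ^ θ / θ
            + 2 * h * (K₁ * ∫ x, |ρ x - ∫ y, ρ y ∂ν| ∂ν + B * ∫ x, |m x - ∫ y, m y ∂ν| ∂ν)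
          ≤ C + ∫ x, g x ∂ν + Ω h := by
  set K₃ := meanConst θ B K K₁ with hK₃
  have hlim : Tendsto (fun h : ℝ => h) (𝓝[>] 0) (𝓝 0) :=
    tendsto_nhdsWithin_of_tendsto_nhds tendsto_id
  have hpow : Tendsto (fun h : ℝ => h ^ (1 - μ * θ)) (𝓝[>] 0) (𝓝 0) := by
    have := hlim.rpow_const (p := 1 - μ * θ) (Or.inr (by linarith))
    rwa [Real.zero_rpow (by linarith)] at this
  have hev : ∀ᶠ h in 𝓝[>] (0 : ℝ), 2 * h ≤ 2 ∧ 2 * B * B * (2 * h) ≤ 1 ∧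
      2 * (2 * K₃) * h ^ (1 - μ * θ) ≤ 1 := by
    have e1 := (hlim.const_mul 2).eventually_le_const (u := 2) (by norm_num)
    have e2 := ((hlim.const_mul 2).const_mul (2 * B * B)).eventually_le_const (u := 1)
      (by norm_num)
    have e3 := (hpow.const_mul (2 * (2 * K₃))).eventually_le_const (u := 1) (by norm_num)
    filter_upwards [e1, e2, e3] with h h1 h2 h3 using ⟨h1, h2, h3⟩
  classical
  refine ⟨fun h => if 2 * h ≤ 2 ∧ 2 * B * B * (2 * h) ≤ 1 ∧
      2 * (2 * K₃) * h ^ (1 - μ * θ) ≤ 1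
    then h * (8 * K₃ ^ 2 * h ^ (1 - μ * θ) + 8 * B ^ 2 * K * h)
    else 2 * h * (2 * K + 2 * B * K₁ + 2 * B ^ 3), ?_, ?_⟩
  · have h1 : Tendsto (fun h : ℝ => 8 * K₃ ^ 2 * h ^ (1 - μ * θ) + 8 * B ^ 2 * K * h)
        (𝓝[>] 0) (𝓝 0) := by
      simpa using (hpow.const_mul (8 * K₃ ^ 2)).add (hlim.const_mul (8 * B ^ 2 * K))
    have h2 : (fun h : ℝ => h * (8 * K₃ ^ 2 * h ^ (1 - μ * θ) + 8 * B ^ 2 * K * h))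
        =o[𝓝[>] 0] (fun h : ℝ => h) := by
      have := (isBigO_refl (fun h : ℝ => h) (𝓝[>] 0)).mul_isLittleO
        ((isLittleO_one_iff ℝ).2 h1)
      simpa using this
    refine h2.congr' ?_ EventuallyEq.rfl
    filter_upwards [hev] with h hh
    rw [if_pos hh]
  · intro h ν ρ m g C hh hν hρ hm hg hcone hgK hC hr
    have hμpos : 0 < h ^ μ := Real.rpow_pos_of_pos hh _
    have hr0 := hμpos.trans_le hr
    dsimp only
    split_ifs with hc
    · have hrθ : h ^ (μ * θ) ≤ (∫ x, ρ x ∂ν) ^ θ := by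
        rw [Real.rpow_mul hh.le]; exact Real.rpow_le_rpow hμpos.le hr hθ.le
      have hmul : h ^ (μ * θ) * h ^ (1 - μ * θ) = h := by
        rw [← Real.rpow_add hh]; simp
      have hp1 : 0 < h ^ (μ * θ) := Real.rpow_pos_of_pos hh _
      have hsm : 2 * (2 * h) * K₃ ≤ (∫ x, ρ x ∂ν) ^ θ := by
        refine le_trans ?_ hrθ
        have := mul_le_mul_of_nonneg_left hc.2.2 hp1.le
        calc 2 * (2 * h) * K₃ = 2 * (2 * K₃) * h := by ring
          _ = h ^ (μ * θ) * (2 * (2 * K₃) * h ^ (1 - μ * θ)) := by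
            conv_lhs => rw [← hmul]
            ring
          _ ≤ _ := by linarith
      have := mean_invariant_le_of_small hθ hθ1 hB hK hK₁ (H := 2 * h) (by linarith) hc.1 hc.2.1
        hρ hm hg hcone hgK hC hr0 hsm
      refine this.trans ?_
      have h2 : 2 * (2 * h * K₃) ^ 2 / (∫ x, ρ x ∂ν) ^ θ
          ≤ h * (8 * K₃ ^ 2 * h ^ (1 - μ * θ)) := by
        rw [div_le_iff₀ (hp1.trans_le hrθ)]
        calc 2 * (2 * h * K₃) ^ 2 = 8 * K₃ ^ 2 * h * h := by ring
          _ = 8 * K₃ ^ 2 * h * (h ^ (1 - μ * θ) * h ^ (μ * θ)) := by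
            rw [mul_comm (h ^ (1 - μ * θ)), hmul]
          _ ≤ 8 * K₃ ^ 2 * h * (h ^ (1 - μ * θ) * (∫ x, ρ x ∂ν) ^ θ) := by gcongr
          _ = _ := by ring
      linarith
    · exact mean_invariant_le hθ hB hK hK₁ (by linarith) hρ hm hg hcone hgK hC hr0

/-! ### Profiles and their cell averages -/

/-- A state function of `x` at a fixed time: measurable, equal to `(ρb, 0)` outside a finite
interval, and with values in the cone of bounded density and velocity. -/
structure IsProfile (ρb B : ℝ) (v : ℝ → ℝ × ℝ) : Prop where
  aemeasurable : AEMeasurable v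
  far : ∃ X : ℝ, ∀ x, X < |x| → v x = (ρb, 0)
  mem_cone : ∀ᵐ x, v x ∈ Cone B

/-- The uniform probability measure on `(a, a + 2 h]`. -/
def cellMeasure (h a : ℝ) : Measure ℝ :=
  ENNReal.ofReal (1 / (2 * h)) • volume.restrict (Ioc a (a + 2 * h))

/-- The mean state of `v` over `[a, a + 2 h]`. -/
def cellMean (h : ℝ) (v : ℝ → ℝ × ℝ) (a : ℝ) : ℝ × ℝ :=
  (1 / (2 * h) * ∫ x in a..a + 2 * h, (v x).1, 1 / (2 * h) * ∫ x in a..a + 2 * h, (v x).2)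

/-- The mean over `x` in `[a, a + 2 h]` of the integrals over `[a, x]` of the Taylor remainder of
the energy about the mean state. -/
def cellRemainder (γ h : ℝ) (v : ℝ → ℝ × ℝ) (a : ℝ) : ℝ :=
  1 / (2 * h) * ∫ x in a..a + 2 * h, ∫ y in a..x, taylorRemainder γ (cellMean h v a) (v y)

lemma isProbabilityMeasure_cellMeasure {h : ℝ} (hh : 0 < h) (a : ℝ) :
    IsProbabilityMeasure (cellMeasure h a) := by
  constructor
  simp only [cellMeasure, Measure.smul_apply, Measure.restrict_apply_univ, Real.volume_Ioc,
    smul_eq_mul]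
  rw [← ENNReal.ofReal_mul (by positivity)]
  rw [show 1 / (2 * h) * (a + 2 * h - a) = 1 by field_simp; ring]
  simp

lemma integral_cellMeasure {h : ℝ} (hh : 0 < h) (a : ℝ) (f : ℝ → ℝ) :
    ∫ x, f x ∂(cellMeasure h a) = 1 / (2 * h) * ∫ x in a..a + 2 * h, f x := by
  rw [cellMeasure, integral_smul_measure, ENNReal.toReal_ofReal (by positivity),
    intervalIntegral.integral_of_le (by linarith), smul_eq_mul]

lemma ae_cellMeasure {h a : ℝ} {p : ℝ → Prop} (hp : ∀ᵐ x, x ∈ Ioc a (a + 2 * h) → p x) :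
    ∀ᵐ x ∂(cellMeasure h a), p x :=
  Measure.ae_smul_measure ((ae_restrict_iff' measurableSet_Ioc).2 hp) _

lemma aemeasurable_cellMeasure {α : Type*} [MeasurableSpace α] {f : ℝ → α} (hf : AEMeasurable f)
    (h a : ℝ) : AEMeasurable f (cellMeasure h a) :=
  hf.restrict.smul_measure _

lemma cellMean_eq_integral {h : ℝ} (hh : 0 < h) (v : ℝ → ℝ × ℝ) (a : ℝ) :
    cellMean h v a = (∫ x, (v x).1 ∂(cellMeasure h a), ∫ x, (v x).2 ∂(cellMeasure h a)) := by
  rw [cellMean, integral_cellMeasure hh, integral_cellMeasure hh]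

lemma integrable_of_far {f : ℝ → ℝ} (hf : AEMeasurable f) {K X : ℝ} (hK : ∀ᵐ x, |f x| ≤ K)
    (hX : ∀ x, X < |x| → f x = 0) : Integrable f := by
  have hs : Function.support f ⊆ Icc (-X) X := by
    intro x hx
    by_contra hcon
    refine hx (hX x ?_)
    by_contra! h
    exact hcon (abs_le.1 h)
  rw [← integrableOn_iff_integrable_of_support_subset hs]
  exact integrable_of_ae_abs_le hf.restrict (ae_restrict_of_ae hK)

lemma AEMeasurable.intervalIntegrable_of_bound {f : ℝ → ℝ} (hf : AEMeasurable f) {K : ℝ}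
    (hK : ∀ᵐ x, |f x| ≤ K) (a b : ℝ) : IntervalIntegrable f volume a b :=
  ⟨integrable_of_ae_abs_le hf.restrict (ae_restrict_of_ae hK),
    integrable_of_ae_abs_le hf.restrict (ae_restrict_of_ae hK)⟩

namespace IsProfile

variable {γ ρb B h : ℝ} {v v' : ℝ → ℝ × ℝ}

lemma fst_bound (hv : IsProfile ρb B v) : ∀ᵐ x, |(v x).1| ≤ B := by
  filter_upwards [hv.mem_cone] with x hx
  rw [abs_of_nonneg hx.1]; exact hx.2.1

lemma snd_bound (hv : IsProfile ρb B v) (hB : 0 < B) : ∀ᵐ x, |(v x).2| ≤ B * B := by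
  filter_upwards [hv.mem_cone] with x hx
  exact cone_momentum_le hB.le hx

lemma energy_bound (hv : IsProfile ρb B v) (hγ : 1 < γ) (hB : 0 < B) :
    ∀ᵐ x, |energy γ (v x)| ≤ B ^ 3 + 1 / (γ * (γ - 1)) * B ^ γ := by
  filter_upwards [hv.mem_cone] with x hx
  exact abs_energy_le hγ hB.le hx

lemma relEnergy_bound (hv : IsProfile ρb B v) (hγ : 1 < γ) (hρb : 0 < ρb) (hB : 0 < B) :
    ∀ᵐ x, |relEnergy γ ρb (v x)| ≤ relEnergyBound γ ρb B := by
  filter_upwards [hv.mem_cone] with x hx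
  rw [abs_of_nonneg (relEnergy_nonneg hγ hρb hx.1)]
  exact relEnergy_le hγ hρb hB.le hx

lemma aemeasurable_energy (hv : IsProfile ρb B v) : AEMeasurable (fun x => energy γ (v x)) :=
  (measurable_energy γ).comp_aemeasurable hv.aemeasurable

lemma aemeasurable_relEnergy (hv : IsProfile ρb B v) :
    AEMeasurable (fun x => relEnergy γ ρb (v x)) :=
  (measurable_relEnergy γ ρb).comp_aemeasurable hv.aemeasurable

lemma intervalIntegrable_fst (hv : IsProfile ρb B v) (a b : ℝ) :
    IntervalIntegrable (fun x => (v x).1) volume a b :=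
  AEMeasurable.intervalIntegrable_of_bound hv.aemeasurable.fst hv.fst_bound a b

lemma intervalIntegrable_snd (hv : IsProfile ρb B v) (hB : 0 < B) (a b : ℝ) :
    IntervalIntegrable (fun x => (v x).2) volume a b :=
  AEMeasurable.intervalIntegrable_of_bound hv.aemeasurable.snd (hv.snd_bound hB) a b

lemma intervalIntegrable_energy (hv : IsProfile ρb B v) (hγ : 1 < γ) (hB : 0 < B) (a b : ℝ) :
    IntervalIntegrable (fun x => energy γ (v x)) volume a b :=
  AEMeasurable.intervalIntegrable_of_bound hv.aemeasurable_energy (hv.energy_bound hγ hB) a b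

lemma integrable_relEnergy (hv : IsProfile ρb B v) (hγ : 1 < γ) (hρb : 0 < ρb) (hB : 0 < B) :
    Integrable (fun x => relEnergy γ ρb (v x)) := by
  obtain ⟨X, hX⟩ := hv.far
  refine integrable_of_far hv.aemeasurable_relEnergy (hv.relEnergy_bound hγ hρb hB) (X := X) ?_
  intro x hx
  rw [hX x hx, relEnergy_far hγ hρb]

lemma integrable_energy_sub (hv : IsProfile ρb B v) (hv' : IsProfile ρb B v') (hγ : 1 < γ)
    (hB : 0 < B) : Integrable (fun x => energy γ (v x) - energy γ (v' x)) := by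
  obtain ⟨X, hX⟩ := hv.far
  obtain ⟨X', hX'⟩ := hv'.far
  refine integrable_of_far (hv.aemeasurable_energy.sub hv'.aemeasurable_energy)
    (K := 2 * (B ^ 3 + 1 / (γ * (γ - 1)) * B ^ γ)) (X := max X X') ?_ ?_
  · filter_upwards [hv.energy_bound hγ hB, hv'.energy_bound hγ hB] with x h1 h2
    exact (abs_sub _ _).trans (by linarith)
  · intro x hx
    rw [hX x ((le_max_left _ _).trans_lt hx), hX' x ((le_max_right _ _).trans_lt hx), sub_self]

lemma integrable_fst_sub (hv : IsProfile ρb B v) (hv' : IsProfile ρb B v') :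
    Integrable (fun x => (v x).1 - (v' x).1) := by
  obtain ⟨X, hX⟩ := hv.far
  obtain ⟨X', hX'⟩ := hv'.far
  refine integrable_of_far (hv.aemeasurable.fst.sub hv'.aemeasurable.fst)
    (K := 2 * B) (X := max X X') ?_ ?_
  · filter_upwards [hv.fst_bound, hv'.fst_bound] with x h1 h2
    exact (abs_sub _ _).trans (by linarith)
  · intro x hx
    rw [hX x ((le_max_left _ _).trans_lt hx), hX' x ((le_max_right _ _).trans_lt hx), sub_self]

lemma cellMean_mem_cone (hv : IsProfile ρb B v) (hB : 0 < B) (hh : 0 < h) (a : ℝ) :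
    cellMean h v a ∈ Cone B := by
  have := isProbabilityMeasure_cellMeasure hh a
  have hc : ∀ᵐ x ∂(cellMeasure h a), v x ∈ Cone B :=
    ae_cellMeasure (hv.mem_cone.mono fun x hx _ => hx)
  have hm := aemeasurable_cellMeasure hv.aemeasurable h a
  have i1 : Integrable (fun x => (v x).1) (cellMeasure h a) :=
    integrable_of_ae_abs_le hm.fst (ae_cellMeasure (hv.fst_bound.mono fun x hx _ => hx))
  have i2 : Integrable (fun x => (v x).2) (cellMeasure h a) :=
    integrable_of_ae_abs_le hm.snd (ae_cellMeasure ((hv.snd_bound hB).mono fun x hx _ => hx))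
  rw [cellMean_eq_integral hh]
  refine ⟨integral_nonneg_of_ae (hc.mono fun x hx => hx.1), ?_, ?_⟩
  · simpa using integral_mono_ae i1 (integrable_const B) (hc.mono fun x hx => hx.2.1)
  · refine abs_integral_le_integral_abs.trans ?_
    rw [← integral_const_mul]
    exact integral_mono_ae i2.abs (i1.const_mul B) (hc.mono fun x hx => hx.2.2)

/-- Taylor's formula about the mean state holds even in vacuum cells, as there the state is
constant almost everywhere. -/
lemma taylor_cellMean (hv : IsProfile ρb B v) (hγ : 1 < γ) (hB : 0 < B) (hh : 0 < h) (a : ℝ) :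
    ∀ᵐ x, x ∈ Ioc a (a + 2 * h) → taylorRemainder γ (cellMean h v a) (v x)
      = energy γ (v x) - energy γ (cellMean h v a)
        - energyGrad γ (cellMean h v a) (v x - cellMean h v a) := by
  have hE := hv.cellMean_mem_cone hB hh a
  rcases hE.1.eq_or_lt with h0 | h0
  · have hE0 := eq_zero_of_mem_cone hE h0.symm
    have h1 : ∫ x in Ioc a (a + 2 * h), (v x).1 = 0 := by
      have : 1 / (2 * h) * ∫ x in a..a + 2 * h, (v x).1 = 0 := h0.symm
      rw [intervalIntegral.integral_of_le (by linarith)] at this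
      exact (mul_eq_zero.1 this).resolve_left (by positivity)
    have hi : IntegrableOn (fun x => (v x).1) (Ioc a (a + 2 * h)) :=
      integrable_of_ae_abs_le hv.aemeasurable.fst.restrict (ae_restrict_of_ae hv.fst_bound)
    rw [setIntegral_eq_zero_iff_of_nonneg_ae
      (ae_restrict_of_ae (hv.mem_cone.mono fun x hx => hx.1)) hi] at h1
    rw [Filter.EventuallyEq, ae_restrict_iff' measurableSet_Ioc] at h1
    filter_upwards [h1, hv.mem_cone] with x hx hc hxm
    have : v x = 0 := eq_zero_of_mem_cone hc (hx hxm)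
    rw [hE0, this, taylorRemainder_self]
    simp [energyGrad]
  · filter_upwards [hv.mem_cone] with x hx _
    exact taylor_energy hγ h0 hx

lemma intervalIntegral_sub_cellMean_fst (hv : IsProfile ρb B v) (hh : 0 < h) (a : ℝ) :
    ∫ x in a..a + 2 * h, ((v x).1 - (cellMean h v a).1) = 0 := by
  rw [intervalIntegral.integral_sub (hv.intervalIntegrable_fst _ _) intervalIntegrable_const,
    intervalIntegral.integral_const, cellMean]
  simp; field_simp; ring

lemma intervalIntegral_sub_cellMean_snd (hv : IsProfile ρb B v) (hB : 0 < B) (hh : 0 < h) (a : ℝ) :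
    ∫ x in a..a + 2 * h, ((v x).2 - (cellMean h v a).2) = 0 := by
  rw [intervalIntegral.integral_sub (hv.intervalIntegrable_snd hB _ _) intervalIntegrable_const,
    intervalIntegral.integral_const, cellMean]
  simp; field_simp; ring

/-- Averaging decreases the energy of a cell. -/
lemma cell_energy_loss_nonneg (hv : IsProfile ρb B v) (hγ : 1 < γ) (hB : 0 < B) (hh : 0 < h)
    (a : ℝ) : 0 ≤ ∫ x in a..a + 2 * h, (energy γ (v x) - energy γ (cellMean h v a)) := by
  set E := cellMean h v a with hEdef
  have hE := hv.cellMean_mem_cone hB hh a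
  have hi : IntervalIntegrable (fun x => energyGrad γ E (v x - E)) volume a (a + 2 * h) := by
    unfold energyGrad
    exact (((hv.intervalIntegrable_fst _ _).sub intervalIntegrable_const).const_mul _).add
      (((hv.intervalIntegrable_snd hB _ _).sub intervalIntegrable_const).const_mul _)
  have h0 : ∫ x in a..a + 2 * h, energyGrad γ E (v x - E) = 0 := by
    unfold energyGrad
    simp only [Prod.fst_sub, Prod.snd_sub]
    rw [intervalIntegral.integral_add
      (((hv.intervalIntegrable_fst _ _).sub intervalIntegrable_const).const_mul _)
      (((hv.intervalIntegrable_snd hB _ _).sub intervalIntegrable_const).const_mul _),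
      intervalIntegral.integral_const_mul, intervalIntegral.integral_const_mul,
      hv.intervalIntegral_sub_cellMean_fst hh, hv.intervalIntegral_sub_cellMean_snd hB hh]
    simp
  rw [← h0]
  refine intervalIntegral.integral_mono_ae_restrict (by linarith) hi
    ((hv.intervalIntegrable_energy hγ hB _ _).sub intervalIntegrable_const) ?_
  rw [Filter.EventuallyLE, Measure.restrict_congr_set Ioc_ae_eq_Icc.symm,
    ae_restrict_iff' measurableSet_Ioc]
  filter_upwards [hv.taylor_cellMean hγ hB hh a, hv.mem_cone] with x hx hc hxm
  have h1 := taylorRemainder_nonneg (γ := γ) hE.1 hc.1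
  rw [hx hxm] at h1
  linarith

end IsProfile

/-- A bound for the density derivative of the relative energy on the cone. -/
def gradBound (γ ρb B : ℝ) : ℝ :=
  B ^ (γ - 1) / (γ - 1) + B ^ 2 / 2 + ρb ^ (γ - 1) / (γ - 1)

lemma abs_relEnergyGrad_le {γ ρb B : ℝ} (hγ : 1 < γ) (hρb : 0 < ρb) (hB : 0 < B)
    {E d : ℝ × ℝ} (hE : E ∈ Cone B) :
    |energyGrad γ E d - ρb ^ (γ - 1) / (γ - 1) * d.1|
      ≤ gradBound γ ρb B * |d.1| + B * |d.2| := by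
  have hγ1 : 0 < γ - 1 := by linarith
  have hv := cone_velocity_le hB.le hE
  have h1 : (E.2 / E.1) ^ 2 ≤ B ^ 2 := by rw [← sq_abs]; gcongr
  have h2 : E.1 ^ (γ - 1) ≤ B ^ (γ - 1) := Real.rpow_le_rpow hE.1 hE.2.1 hγ1.le
  have h3 : 0 ≤ E.1 ^ (γ - 1) / (γ - 1) := div_nonneg (Real.rpow_nonneg hE.1 _) hγ1.le
  have h4 : E.1 ^ (γ - 1) / (γ - 1) ≤ B ^ (γ - 1) / (γ - 1) := by gcongr
  have h5 : 0 ≤ ρb ^ (γ - 1) / (γ - 1) := by positivity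
  have h6 : 0 ≤ (E.2 / E.1) ^ 2 := sq_nonneg _
  have e : energyGrad γ E d - ρb ^ (γ - 1) / (γ - 1) * d.1
      = (E.1 ^ (γ - 1) / (γ - 1) - 1 / 2 * (E.2 / E.1) ^ 2 - ρb ^ (γ - 1) / (γ - 1)) * d.1
        + E.2 / E.1 * d.2 := by unfold energyGrad; ring
  rw [e]
  refine (abs_add_le _ _).trans ?_
  rw [abs_mul, abs_mul]
  have h7 : |E.1 ^ (γ - 1) / (γ - 1) - 1 / 2 * (E.2 / E.1) ^ 2 - ρb ^ (γ - 1) / (γ - 1)|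
      ≤ gradBound γ ρb B := by
    unfold gradBound
    rw [abs_le]; constructor <;> linarith
  gcongr

/-- The mean of the relative energy to the left, within a cell, is that of the mean state plus the
Taylor remainders, up to the first order terms, which are controlled by the oscillation of the
state. -/
lemma IsProfile.abs_mean_leftEnergy_sub_le {γ ρb B h : ℝ} {v : ℝ → ℝ × ℝ} (hv : IsProfile ρb B v)
    (hγ : 1 < γ) (hρb : 0 < ρb) (hB : 0 < B) (hh : 0 < h) (a : ℝ) :
    |1 / (2 * h) * (∫ x in a..a + 2 * h, ∫ y in a..x, relEnergy γ ρb (v y))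
        - (h * relEnergy γ ρb (cellMean h v a) + cellRemainder γ h v a)|
      ≤ 2 * h * (gradBound γ ρb B * ∫ x, |(v x).1 - (cellMean h v a).1| ∂(cellMeasure h a)
          + B * ∫ x, |(v x).2 - (cellMean h v a).2| ∂(cellMeasure h a)) := by
  have hE := hv.cellMean_mem_cone hB hh a
  unfold cellRemainder
  have htay := hv.taylor_cellMean hγ hB hh a
  set E := cellMean h v a with hEdef
  have j1 : ∀ p q, IntervalIntegrable (fun x => (v x).1 - E.1) volume p q := fun p q =>
    (hv.intervalIntegrable_fst _ _).sub intervalIntegrable_const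
  have j2 : ∀ p q, IntervalIntegrable (fun x => (v x).2 - E.2) volume p q := fun p q =>
    (hv.intervalIntegrable_snd hB _ _).sub intervalIntegrable_const
  set G : ℝ → ℝ := fun y => energyGrad γ E (v y - E) - ρb ^ (γ - 1) / (γ - 1) * (v y - E).1 with hG
  have jG : ∀ p q, IntervalIntegrable G volume p q := fun p q =>
    (((j1 p q).const_mul _).add ((j2 p q).const_mul _)).sub ((j1 p q).const_mul _)
  have jR : IntervalIntegrable (fun y => taylorRemainder γ E (v y)) volume a (a + 2 * h) := by
    refine ((((hv.intervalIntegrable_energy hγ hB a (a + 2 * h)).sub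
      (intervalIntegrable_const (c := energy γ E))).sub
      (((j1 _ _).const_mul (E.1 ^ (γ - 1) / (γ - 1) - 1 / 2 * (E.2 / E.1) ^ 2)).add
        ((j2 _ _).const_mul (E.2 / E.1))))).congr_ae ?_
    rw [uIoc_of_le (by linarith), Filter.EventuallyEq, ae_restrict_iff' measurableSet_Ioc]
    filter_upwards [htay] with x hx hxm
    rw [hx hxm]; rfl
  have jR' : ∀ x ∈ Icc a (a + 2 * h),
      IntervalIntegrable (fun y => taylorRemainder γ E (v y)) volume a x := fun x hx =>
    jR.mono_set (by
      rw [uIcc_of_le hx.1, uIcc_of_le (by linarith)]; exact Icc_subset_Icc le_rfl hx.2)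
  have hdec : ∀ x ∈ Icc a (a + 2 * h), ∫ y in a..x, relEnergy γ ρb (v y)
      = (x - a) * relEnergy γ ρb E + (∫ y in a..x, taylorRemainder γ E (v y))
        + ∫ y in a..x, G y := by
    intro x hx
    have h1 : ∫ y in a..x, relEnergy γ ρb (v y)
        = ∫ y in a..x, (relEnergy γ ρb E + taylorRemainder γ E (v y) + G y) := by
      refine intervalIntegral.integral_congr_ae ?_
      rw [uIoc_of_le hx.1]
      filter_upwards [htay] with y hy hym
      rw [hy ⟨hym.1, hym.2.trans hx.2⟩, hG]
      simp only [relEnergy, Prod.fst_sub]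
      ring
    rw [h1, intervalIntegral.integral_add (intervalIntegrable_const.add (jR' x hx)) (jG _ _),
      intervalIntegral.integral_add intervalIntegrable_const (jR' x hx),
      intervalIntegral.integral_const, smul_eq_mul]
  set T := ∫ y in a..a + 2 * h, |G y| with hT
  have hGle : ∀ x ∈ Icc a (a + 2 * h), |∫ y in a..x, G y| ≤ T := by
    intro x hx
    refine (intervalIntegral.abs_integral_le_integral_abs hx.1).trans ?_
    exact intervalIntegral.integral_mono_interval le_rfl hx.1 hx.2
      (Eventually.of_forall fun y => abs_nonneg _) (jG _ _).abs
  have cR : ContinuousOn (fun x => ∫ y in a..x, taylorRemainder γ E (v y)) (Icc a (a + 2 * h)) := by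
    have := intervalIntegral.continuousOn_primitive_interval (a := a) (b := a + 2 * h)
      (f := fun y => taylorRemainder γ E (v y)) (μ := volume)
      (by rw [uIcc_of_le (by linarith), integrableOn_Icc_iff_integrableOn_Ioc]; exact jR.1)
    rwa [uIcc_of_le (by linarith)] at this
  have iR : IntervalIntegrable (fun x => ∫ y in a..x, taylorRemainder γ E (v y)) volume a
      (a + 2 * h) := by
    apply ContinuousOn.intervalIntegrable; rwa [uIcc_of_le (by linarith)]
  have iG : IntervalIntegrable (fun x => ∫ y in a..x, G y) volume a (a + 2 * h) :=
    (intervalIntegral.continuous_primitive jG a).intervalIntegrable _ _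
  have ilin : IntervalIntegrable (fun x => (x - a) * relEnergy γ ρb E) volume a (a + 2 * h) :=
    Continuous.intervalIntegrable (by fun_prop) _ _
  have h2 : ∫ x in a..a + 2 * h, ∫ y in a..x, relEnergy γ ρb (v y)
      = 2 * h * (h * relEnergy γ ρb E)
        + (∫ x in a..a + 2 * h, ∫ y in a..x, taylorRemainder γ E (v y))
        + ∫ x in a..a + 2 * h, ∫ y in a..x, G y := by
    rw [intervalIntegral.integral_congr (g := fun x => (x - a) * relEnergy γ ρb E
      + (∫ y in a..x, taylorRemainder γ E (v y)) + ∫ y in a..x, G y) (fun x hx => by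
        rw [uIcc_of_le (by linarith)] at hx; exact hdec x hx),
      intervalIntegral.integral_add (ilin.add iR) iG, intervalIntegral.integral_add ilin iR,
      intervalIntegral.integral_mul_const,
      intervalIntegral.integral_comp_sub_right (fun x => x) a, integral_id]
    congr 2
    ring
  have h3 : |∫ x in a..a + 2 * h, ∫ y in a..x, G y| ≤ T * (2 * h) := by
    have := intervalIntegral.norm_integral_le_of_norm_le_const (a := a) (b := a + 2 * h)
      (f := fun x => ∫ y in a..x, G y) (C := T) (fun x hx => by
        rw [uIoc_of_le (by linarith)] at hx; exact hGle x (Ioc_subset_Icc_self hx))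
    rwa [add_sub_cancel_left, abs_of_pos (by positivity : 0 < 2 * h)] at this
  have h4 : T ≤ 2 * h * (gradBound γ ρb B * ∫ x, |(v x).1 - E.1| ∂(cellMeasure h a)
          + B * ∫ x, |(v x).2 - E.2| ∂(cellMeasure h a)) := by
    have h5 : T ≤ ∫ y in a..a + 2 * h, (gradBound γ ρb B * |(v y).1 - E.1|
        + B * |(v y).2 - E.2|) :=
      intervalIntegral.integral_mono_on (by linarith) (jG _ _).abs
        (((j1 _ _).abs.const_mul _).add ((j2 _ _).abs.const_mul _))
        (fun y _ => abs_relEnergyGrad_le hγ hρb hB hE)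
    rw [intervalIntegral.integral_add ((j1 _ _).abs.const_mul _) ((j2 _ _).abs.const_mul _),
      intervalIntegral.integral_const_mul, intervalIntegral.integral_const_mul] at h5
    rw [integral_cellMeasure hh, integral_cellMeasure hh]
    refine h5.trans (le_of_eq ?_)
    field_simp
  refine le_trans ?_ h4
  rw [h2]
  have e : 1 / (2 * h) * (2 * h * (h * relEnergy γ ρb E)
        + (∫ x in a..a + 2 * h, ∫ y in a..x, taylorRemainder γ E (v y))
        + ∫ x in a..a + 2 * h, ∫ y in a..x, G y)
      - (h * relEnergy γ ρb E
        + 1 / (2 * h) * ∫ x in a..a + 2 * h, ∫ y in a..x, taylorRemainder γ E (v y))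
      = (∫ x in a..a + 2 * h, ∫ y in a..x, G y) / (2 * h) := by
    field_simp; ring
  rw [e, abs_div, abs_of_pos (by positivity : 0 < 2 * h), div_le_iff₀ (by positivity)]
  exact h3

/-- Bounds for the Riemann invariants in a cell that grow like the relative energy to the left pass
to the mean state, with the relative energy of the mean state up to the midpoint of the cell and
the Taylor remainders in place, up to an error `o(h)`. -/
lemma exists_cell_error {γ ρb μ B : ℝ} (hγ : 1 < γ) (hγ' : γ ≤ 5 / 3) (hρb : 0 < ρb)
    (hμ' : μ < 1 / (2 * theta γ)) (hB : 0 < B) :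
    ∃ Ω : ℝ → ℝ, Ω =o[𝓝[>] 0] (fun h : ℝ => h) ∧
      ∀ (h : ℝ) (v : ℝ → ℝ × ℝ) (a : ℝ), 0 < h → IsProfile ρb B v →
        h ^ μ ≤ (cellMean h v a).1 →
        (∀ C, (∀ᵐ x, x ∈ Ioc a (a + 2 * h) → 0 < (v x).1 →
            C + ∫ y in a..x, relEnergy γ ρb (v y) ≤ riemannZ γ (v x)) →
          C + (h * relEnergy γ ρb (cellMean h v a) + cellRemainder γ h v a) - Ω h
            ≤ riemannZ γ (cellMean h v a)) ∧
        (∀ C, (∀ᵐ x, x ∈ Ioc a (a + 2 * h) → 0 < (v x).1 →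
            riemannW γ (v x) ≤ C + ∫ y in a..x, relEnergy γ ρb (v y)) →
          riemannW γ (cellMean h v a)
            ≤ C + (h * relEnergy γ ρb (cellMean h v a) + cellRemainder γ h v a) + Ω h) := by
  have hθ : 0 < theta γ := by unfold theta; linarith
  have hθ1 : theta γ ≤ 1 := by unfold theta; linarith
  have hμθ : μ * theta γ < 1 := by
    rw [lt_div_iff₀ (by positivity)] at hμ'
    linarith
  have hγ1 : 0 < γ - 1 := by linarith
  obtain ⟨Ω, hΩ, hmain⟩ := exists_mean_invariant_error hθ hθ1 hB
    (relEnergyBound_nonneg hγ hρb hB.le (γ := γ) (ρb := ρb))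
    (show 0 ≤ gradBound γ ρb B by unfold gradBound; positivity) hμθ
  refine ⟨Ω, hΩ, fun h v a hh hv hr => ?_⟩
  have hprob := isProbabilityMeasure_cellMeasure hh a
  have hmv := aemeasurable_cellMeasure hv.aemeasurable h a
  have hJ : ∀ p q, IntervalIntegrable (fun y => relEnergy γ ρb (v y)) volume p q := fun p q =>
    AEMeasurable.intervalIntegrable_of_bound hv.aemeasurable_relEnergy
      (hv.relEnergy_bound hγ hρb hB) p q
  have hmg : AEMeasurable (fun x => ∫ y in a..x, relEnergy γ ρb (v y)) (cellMeasure h a) :=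
    (intervalIntegral.continuous_primitive hJ a).measurable.aemeasurable
  have hcone : ∀ᵐ x ∂(cellMeasure h a), v x ∈ Cone B :=
    ae_cellMeasure (hv.mem_cone.mono fun x hx _ => hx)
  have hgK : ∀ᵐ x ∂(cellMeasure h a),
      |∫ y in a..x, relEnergy γ ρb (v y)| ≤ 2 * h * relEnergyBound γ ρb B := by
    refine ae_cellMeasure (Eventually.of_forall fun x hx => ?_)
    have h1 := intervalIntegral.norm_integral_le_of_norm_le_const_ae (a := a) (b := x)
      (f := fun y => relEnergy γ ρb (v y)) (C := relEnergyBound γ ρb B)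
      (by filter_upwards [hv.relEnergy_bound hγ hρb hB] with y hy _ using hy)
    rw [Real.norm_eq_abs] at h1
    refine h1.trans ?_
    rw [abs_of_pos (by linarith [hx.1]), mul_comm]
    have := relEnergyBound_nonneg hγ hρb hB.le (γ := γ) (ρb := ρb)
    have := hx.2
    gcongr
    linarith
  have hEeq := cellMean_eq_integral hh v a
  have hE1 : (cellMean h v a).1 = ∫ x, (v x).1 ∂(cellMeasure h a) := by rw [hEeq]
  have hE2 : (cellMean h v a).2 = ∫ x, (v x).2 ∂(cellMeasure h a) := by rw [hEeq]
  have herr := hv.abs_mean_leftEnergy_sub_le hγ hρb hB hh a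
  rw [← integral_cellMeasure hh, abs_le, hE1, hE2] at herr
  set D := h * relEnergy γ ρb (cellMean h v a) + cellRemainder γ h v a with hD
  have hpow : ∀ x, v x ∈ Cone B → (v x).1 ^ (1 + theta γ) = (v x).1 * (v x).1 ^ theta γ :=
    fun x hx => Real.rpow_one_add' hx.1 (by positivity)
  have hzero : (0 : ℝ) ^ (1 + theta γ) = 0 := Real.zero_rpow (by positivity)
  constructor
  · intro C hC
    -- the bound for `-z` is the bound for `w` of the reflected state `(ρ, -m)`
    have := hmain h (cellMeasure h a) (fun x => (v x).1) (fun x => -(v x).2)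
      (fun x => -∫ y in a..x, relEnergy γ ρb (v y)) (-C) hh hprob hmv.fst hmv.snd.neg hmg.neg
      (hcone.mono fun x hx => ⟨hx.1, hx.2.1, by simpa using hx.2.2⟩)
      (hgK.mono fun x hx => by simpa using hx) ?_ (by rw [← hE1]; exact hr)
    · simp only [integral_neg, neg_sub_neg] at this
      rw [integral_congr_ae (g := fun x => |(v x).2 - ∫ y, (v y).2 ∂(cellMeasure h a)|)
        (Eventually.of_forall fun x => abs_sub_comm _ _)] at this
      have hz : riemannZ γ (cellMean h v a) = (∫ x, (v x).2 ∂(cellMeasure h a))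
          / (∫ x, (v x).1 ∂(cellMeasure h a))
          - (∫ x, (v x).1 ∂(cellMeasure h a)) ^ theta γ / theta γ := by
        rw [riemannZ, hE1, hE2]
      rw [hz]
      rw [neg_div] at this
      linarith [herr.1]
    · filter_upwards [hcone, ae_cellMeasure hC] with x hx hCx
      rcases hx.1.eq_or_lt with h0 | h0
      · have := eq_zero_of_mem_cone hx h0.symm
        simp [this, hzero]
      · have h1 := mul_le_mul_of_nonneg_right (hCx h0) h0.le
        rw [riemannZ, sub_mul, div_mul_cancel₀ _ h0.ne'] at h1
        rw [hpow x hx, mul_div_assoc]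
        linarith
  · intro C hC
    have := hmain h (cellMeasure h a) (fun x => (v x).1) (fun x => (v x).2)
      (fun x => ∫ y in a..x, relEnergy γ ρb (v y)) C hh hprob hmv.fst hmv.snd hmg
      hcone hgK ?_ (by rw [← hE1]; exact hr)
    · have hw : riemannW γ (cellMean h v a) = (∫ x, (v x).2 ∂(cellMeasure h a))
          / (∫ x, (v x).1 ∂(cellMeasure h a))
          + (∫ x, (v x).1 ∂(cellMeasure h a)) ^ theta γ / theta γ := by
        rw [riemannW, hE1, hE2]
      rw [hw]
      linarith [herr.2]
    · filter_upwards [hcone, ae_cellMeasure hC] with x hx hCx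
      rcases hx.1.eq_or_lt with h0 | h0
      · have := eq_zero_of_mem_cone hx h0.symm
        simp [this, hzero]
      · have h1 := mul_le_mul_of_nonneg_right (hCx h0) h0.le
        rw [riemannW, add_mul, div_mul_cancel₀ _ h0.ne'] at h1
        rw [hpow x hx, mul_div_assoc]
        linarith

/-! ### The step function of cell averages -/

/-- The left end point `x_{2 i - 1}` of the `i`-th cell. -/
def cellLeft (h : ℝ) (i : ℤ) : ℝ := (2 * i - 1) * h

/-- The step function with the mean state of `v` on every cell. -/
def stepMean (h : ℝ) (v : ℝ → ℝ × ℝ) (x : ℝ) : ℝ × ℝ :=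
  cellMean h v (cellLeft h ⌊(x + h) / (2 * h)⌋)

lemma stepMean_of_mem {h : ℝ} (hh : 0 < h) (v : ℝ → ℝ × ℝ) (i : ℤ) {x : ℝ}
    (hx : x ∈ Ioo (cellLeft h i) (cellLeft h i + 2 * h)) :
    stepMean h v x = cellMean h v (cellLeft h i) := by
  have : ⌊(x + h) / (2 * h)⌋ = i := by
    obtain ⟨h1, h2⟩ := hx
    unfold cellLeft at h1 h2
    rw [Int.floor_eq_iff, le_div_iff₀ (by positivity), div_lt_iff₀ (by positivity)]
    constructor <;> nlinarith
  rw [stepMean, this]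

lemma cellMean_of_forall_eq {h a : ℝ} (hh : 0 < h) {v : ℝ → ℝ × ℝ} {c : ℝ × ℝ}
    (hv : ∀ x ∈ Ioc a (a + 2 * h), v x = c) : cellMean h v a = c := by
  have h1 : ∫ x in a..a + 2 * h, (v x).1 = ∫ x in a..a + 2 * h, c.1 := by
    rw [intervalIntegral.integral_of_le (by linarith),
      intervalIntegral.integral_of_le (by linarith)]
    exact setIntegral_congr_fun measurableSet_Ioc fun x hx => by simp [hv x hx]
  have h2 : ∫ x in a..a + 2 * h, (v x).2 = ∫ x in a..a + 2 * h, c.2 := by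
    rw [intervalIntegral.integral_of_le (by linarith),
      intervalIntegral.integral_of_le (by linarith)]
    exact setIntegral_congr_fun measurableSet_Ioc fun x hx => by simp [hv x hx]
  rw [cellMean, h1, h2]
  ext <;> simp <;> field_simp

lemma IsProfile.stepMean {ρb B h : ℝ} {v : ℝ → ℝ × ℝ} (hv : IsProfile ρb B v) (hB : 0 < B)
    (hh : 0 < h) : IsProfile ρb B (stepMean h v) where
  aemeasurable := by
    have h1 : Measurable fun i : ℤ => cellMean h v (cellLeft h i) := measurable_from_top
    exact (h1.comp (Int.measurable_floor.comp
      (show Measurable fun x : ℝ => (x + h) / (2 * h) by fun_prop))).aemeasurable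
  far := by
    obtain ⟨X, hX⟩ := hv.far
    refine ⟨X + 2 * h, fun x hx => cellMean_of_forall_eq hh fun y hy => hX y ?_⟩
    have h1 := Int.floor_le ((x + h) / (2 * h))
    have h2 := Int.lt_floor_add_one ((x + h) / (2 * h))
    rw [le_div_iff₀ (by positivity)] at h1
    rw [div_lt_iff₀ (by positivity)] at h2
    unfold cellLeft at hy
    have h3 : |x - y| ≤ 2 * h := by rw [abs_le]; constructor <;> nlinarith [hy.1, hy.2]
    linarith [abs_sub_abs_le_abs_sub x y]
  mem_cone := Eventually.of_forall fun _ => hv.cellMean_mem_cone hB hh _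

lemma intervalIntegral_stepMean {h : ℝ} (hh : 0 < h) (v : ℝ → ℝ × ℝ) (i : ℤ)
    (F : ℝ → ℝ × ℝ → ℝ) :
    ∫ x in Ioc (cellLeft h i) (cellLeft h i + 2 * h), F x (stepMean h v x)
      = ∫ x in cellLeft h i..cellLeft h i + 2 * h, F x (cellMean h v (cellLeft h i)) := by
  rw [intervalIntegral.integral_of_le (by linarith), integral_Ioc_eq_integral_Ioo,
    integral_Ioc_eq_integral_Ioo]
  exact setIntegral_congr_fun measurableSet_Ioo fun x hx => by
    simp only [stepMean_of_mem hh v i hx]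

/-! ### Summation over the cells -/

/-- The index of the cell `(x_{2 i - 1}, x_{2 i + 1}]` that contains `x`. -/
lemma mem_cell_iff {h : ℝ} (hh : 0 < h) (i : ℤ) (x : ℝ) :
    x ∈ Ioc (cellLeft h i) (cellLeft h i + 2 * h) ↔ ⌈(x + h) / (2 * h)⌉ = i + 1 := by
  rw [Int.ceil_eq_iff, lt_div_iff₀ (by positivity), div_le_iff₀ (by positivity)]
  unfold cellLeft
  push_cast
  constructor
  · rintro ⟨h1, h2⟩; constructor <;> nlinarith
  · rintro ⟨h1, h2⟩; constructor <;> nlinarith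

lemma setIntegral_cells_nonneg {h : ℝ} (hh : 0 < h) {f : ℝ → ℝ} (hf : Integrable f)
    (hc : ∀ i : ℤ, 0 ≤ ∫ x in Ioc (cellLeft h i) (cellLeft h i + 2 * h), f x) (P : Set ℤ) :
    0 ≤ ∫ x in {x | ⌈(x + h) / (2 * h)⌉ - 1 ∈ P}, f x := by
  have hU : {x | ⌈(x + h) / (2 * h)⌉ - 1 ∈ P}
      = ⋃ i : P, Ioc (cellLeft h i) (cellLeft h i + 2 * h) := by
    ext x
    simp only [mem_ofPred_eq, mem_iUnion, mem_cell_iff hh]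
    constructor
    · intro hx; exact ⟨⟨_, hx⟩, by simp⟩
    · rintro ⟨i, hi⟩; rw [hi]; simp
  rw [hU, integral_iUnion (fun _ => measurableSet_Ioc) ?_ hf.integrableOn]
  · exact tsum_nonneg fun i => hc i
  · intro i j hij
    rw [Function.onFun, Set.disjoint_left]
    intro x hx hx'
    rw [mem_cell_iff hh] at hx hx'
    exact hij (Subtype.ext (by omega))

lemma Iic_cellLeft_eq {h : ℝ} (hh : 0 < h) (i : ℤ) :
    Iic (cellLeft h i) = {x | ⌈(x + h) / (2 * h)⌉ - 1 ∈ Iio i} := by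
  ext x
  simp only [mem_Iic, mem_ofPred_eq, mem_Iio, Int.sub_one_lt_iff, Int.ceil_le]
  rw [div_le_iff₀ (by positivity)]
  unfold cellLeft
  constructor <;> intro h1 <;> nlinarith

lemma Ioi_cellLeft_eq {h : ℝ} (hh : 0 < h) (i : ℤ) :
    Ioi (cellLeft h i) = {x | ⌈(x + h) / (2 * h)⌉ - 1 ∈ Ici i} := by
  have h1 := Iic_cellLeft_eq hh i
  rw [← compl_Iic, h1]
  ext x; simp

namespace IsProfile

variable {γ ρb B h : ℝ} {v : ℝ → ℝ × ℝ}

lemma cell_energy_sub_nonneg (hv : IsProfile ρb B v) (hγ : 1 < γ) (hB : 0 < B) (hh : 0 < h)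
    (i : ℤ) : 0 ≤ ∫ x in Ioc (cellLeft h i) (cellLeft h i + 2 * h),
      (energy γ (v x) - energy γ (IsentropicGas.stepMean h v x)) := by
  rw [intervalIntegral_stepMean hh v i (fun x s => energy γ (v x) - energy γ s)]
  exact hv.cell_energy_loss_nonneg hγ hB hh _

/-- The averaging step loses energy to the left of every cell boundary, and it loses as much in
relative energy since it preserves the mass of every cell. The loss is at most the total one. -/
lemma leftEnergy_loss (hv : IsProfile ρb B v) (hγ : 1 < γ) (hρb : 0 < ρb) (hB : 0 < B)
    (hh : 0 < h) (i : ℤ) :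
    ∫ x in Iic (cellLeft h i), relEnergy γ ρb (IsentropicGas.stepMean h v x)
        ≤ ∫ x in Iic (cellLeft h i), relEnergy γ ρb (v x) ∧
      ∫ x in Iic (cellLeft h i), relEnergy γ ρb (v x)
        ≤ (∫ x in Iic (cellLeft h i), relEnergy γ ρb (IsentropicGas.stepMean h v x))
          + ∫ x, (energy γ (v x) - energy γ (IsentropicGas.stepMean h v x)) := by
  have hs := hv.stepMean hB hh
  have hi := hv.integrable_energy_sub hs hγ hB
  have hρ := hv.integrable_fst_sub hs
  have hL := setIntegral_cells_nonneg hh hi (hv.cell_energy_sub_nonneg hγ hB hh) (Iio i)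
  have hR := setIntegral_cells_nonneg hh hi (hv.cell_energy_sub_nonneg hγ hB hh) (Ici i)
  rw [← Iic_cellLeft_eq hh] at hL
  rw [← Ioi_cellLeft_eq hh] at hR
  have hcell : ∀ i : ℤ, ∫ x in Ioc (cellLeft h i) (cellLeft h i + 2 * h),
      ((v x).1 - (IsentropicGas.stepMean h v x).1) = 0 := fun i => by
    rw [intervalIntegral_stepMean hh v i (fun x s => (v x).1 - s.1)]
    exact hv.intervalIntegral_sub_cellMean_fst hh _
  have hm1 := setIntegral_cells_nonneg hh hρ (fun i => (hcell i).ge) (Iio i)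
  have hm2 := setIntegral_cells_nonneg hh hρ.neg (fun i => by
    simp only [Pi.neg_apply]; rw [integral_neg, hcell, neg_zero]) (Iio i)
  simp only [Pi.neg_apply] at hm2
  rw [← Iic_cellLeft_eq hh] at hm1 hm2
  rw [integral_neg] at hm2
  have hmass : ∫ x in Iic (cellLeft h i), ((v x).1 - (IsentropicGas.stepMean h v x).1) = 0 := by
    linarith
  have htot := intervalIntegral.integral_Iic_add_Ioi (b := cellLeft h i) hi.integrableOn
    hi.integrableOn
  have hdiff : (∫ x in Iic (cellLeft h i), relEnergy γ ρb (v x))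
      - ∫ x in Iic (cellLeft h i), relEnergy γ ρb (IsentropicGas.stepMean h v x)
      = ∫ x in Iic (cellLeft h i), (energy γ (v x) - energy γ (IsentropicGas.stepMean h v x)) := by
    rw [← integral_sub (hv.integrable_relEnergy hγ hρb hB).integrableOn
      (hs.integrable_relEnergy hγ hρb hB).integrableOn]
    have e : ∀ x, relEnergy γ ρb (v x) - relEnergy γ ρb (IsentropicGas.stepMean h v x)
        = (energy γ (v x) - energy γ (IsentropicGas.stepMean h v x))
          - ρb ^ (γ - 1) / (γ - 1) * ((v x).1 - (IsentropicGas.stepMean h v x).1) := by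
      intro x; unfold relEnergy; ring
    simp only [e]
    rw [integral_sub hi.integrableOn (hρ.integrableOn.const_mul _), integral_const_mul, hmass]
    ring
  constructor <;> linarith

lemma leftEnergy_stepMean (hv : IsProfile ρb B v) (hγ : 1 < γ) (hρb : 0 < ρb) (hB : 0 < B)
    (hh : 0 < h) (i : ℤ) :
    ∫ x in Iic (cellLeft h i + h), relEnergy γ ρb (IsentropicGas.stepMean h v x)
      = (∫ x in Iic (cellLeft h i), relEnergy γ ρb (IsentropicGas.stepMean h v x))
        + h * relEnergy γ ρb (cellMean h v (cellLeft h i)) := by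
  have hi := (hv.stepMean hB hh).integrable_relEnergy hγ hρb hB
  have h1 := intervalIntegral.integral_Iic_sub_Iic (a := cellLeft h i) (b := cellLeft h i + h)
    hi.integrableOn hi.integrableOn
  have h2 : ∫ x in cellLeft h i..cellLeft h i + h, relEnergy γ ρb (IsentropicGas.stepMean h v x)
      = h * relEnergy γ ρb (cellMean h v (cellLeft h i)) := by
    rw [intervalIntegral.integral_of_le (by linarith), integral_Ioc_eq_integral_Ioo,
      setIntegral_congr_fun (g := fun _ => relEnergy γ ρb (cellMean h v (cellLeft h i)))
        measurableSet_Ioo (fun x hx => by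
          simp only [stepMean_of_mem hh v i ⟨hx.1, by linarith [hx.2]⟩])]
    simp [hh.le]
  linarith

lemma cellRemainder_nonneg (hv : IsProfile ρb B v) (hB : 0 < B) (hh : 0 < h) (a : ℝ) :
    0 ≤ cellRemainder γ h v a := by
  unfold cellRemainder
  refine mul_nonneg (by positivity) (intervalIntegral.integral_nonneg (by linarith) fun x hx => ?_)
  refine intervalIntegral.integral_nonneg_of_ae_restrict hx.1 (ae_restrict_of_ae ?_)
  filter_upwards [hv.mem_cone] with y hy
  exact taylorRemainder_nonneg (hv.cellMean_mem_cone hB hh a).1 hy.1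

lemma summable_cellRemainder (hv : IsProfile ρb B v) (hh : 0 < h) :
    Summable fun i : ℤ => cellRemainder γ h v (cellLeft h i) := by
  obtain ⟨X, hX⟩ := hv.far
  apply summable_of_hasFiniteSupport
  -- only the cells that meet `[-X, X]` contribute
  refine (Set.finite_Icc (-⌈X / h + 2⌉) ⌈X / h + 2⌉).subset fun i hi => ?_
  by_contra hcon
  refine hi ?_
  have hcell : ∀ x ∈ Icc (cellLeft h i) (cellLeft h i + 2 * h), v x = (ρb, 0) := by
    intro x hx
    apply hX
    have hX2 : X / h + 2 < |(i : ℝ)| := by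
      by_contra! hc
      have := hc.trans (Int.le_ceil _)
      rw [← Int.cast_abs] at this
      have := Int.cast_le.1 this
      exact hcon (abs_le.1 this)
    have h3 : X < (|(i : ℝ)| - 2) * h := by
      rw [← div_lt_iff₀ hh]; linarith
    obtain ⟨h1, h2⟩ := hx
    unfold cellLeft at h1 h2
    have h5 : |(i : ℝ)| * h ≤ |x| + h := by
      have h6 : |(2 * (i : ℝ) * h)| ≤ |x| + h := by
        have h7 : |2 * (i : ℝ) * h - x| ≤ h := by rw [abs_le]; constructor <;> linarith
        linarith [abs_sub_abs_le_abs_sub (2 * (i : ℝ) * h) x]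
      rw [abs_mul, abs_mul, abs_of_pos hh, abs_of_pos (by norm_num : (0 : ℝ) < 2)] at h6
      nlinarith [mul_nonneg (abs_nonneg (i : ℝ)) hh.le]
    nlinarith
  have hmean := cellMean_of_forall_eq hh (fun x hx => hcell x (Ioc_subset_Icc_self hx))
  simp only [cellRemainder, hmean]
  rw [intervalIntegral.integral_congr (g := fun _ => 0), intervalIntegral.integral_zero, mul_zero]
  intro x hx
  rw [uIcc_of_le (by linarith)] at hx
  simp only
  rw [intervalIntegral.integral_congr (g := fun _ => 0), intervalIntegral.integral_zero]
  intro y hy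
  rw [uIcc_of_le hx.1] at hy
  simp only
  rw [hcell y ⟨hy.1, hy.2.trans hx.2⟩, taylorRemainder_self]

end IsProfile

/-- The effect of one averaging step on bounds for the Riemann invariants: the bounds persist, with
the relative energy of the step function in place of that of `v`, at the price of the energy lost,
of the Taylor remainders, and of an error `o(h)`. -/
lemma exists_averaging_error {γ ρb μ B : ℝ} (hγ : 1 < γ) (hγ' : γ ≤ 5 / 3) (hρb : 0 < ρb)
    (hμ' : μ < 1 / (2 * theta γ)) (hB : 0 < B) :
    ∃ Ω : ℝ → ℝ, Ω =o[𝓝[>] 0] (fun h : ℝ => h) ∧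
      ∀ (h : ℝ) (v : ℝ → ℝ × ℝ) (i : ℤ), 0 < h → IsProfile ρb B v →
        h ^ μ ≤ (cellMean h v (cellLeft h i)).1 →
        (∀ C, (∀ᵐ x, x ∈ Ioc (cellLeft h i) (cellLeft h i + 2 * h) → 0 < (v x).1 →
            C + ∫ y in Iic x, relEnergy γ ρb (v y) ≤ riemannZ γ (v x)) →
          C - ((∫ x, (energy γ (v x) - energy γ (stepMean h v x)))
              + ∑' i : ℤ, cellRemainder γ h v (cellLeft h i))
            + (∫ x in Iic (cellLeft h i + h), relEnergy γ ρb (stepMean h v x)) - Ω h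
            ≤ riemannZ γ (cellMean h v (cellLeft h i))) ∧
        (∀ C, (∀ᵐ x, x ∈ Ioc (cellLeft h i) (cellLeft h i + 2 * h) → 0 < (v x).1 →
            riemannW γ (v x) ≤ C + ∫ y in Iic x, relEnergy γ ρb (v y)) →
          riemannW γ (cellMean h v (cellLeft h i))
            ≤ C + ((∫ x, (energy γ (v x) - energy γ (stepMean h v x)))
                + ∑' i : ℤ, cellRemainder γ h v (cellLeft h i))
              + (∫ x in Iic (cellLeft h i + h), relEnergy γ ρb (stepMean h v x)) + Ω h) := by
  obtain ⟨Ω, hΩ, hmain⟩ := exists_cell_error hγ hγ' hρb hμ' hB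
  refine ⟨Ω, hΩ, fun h v i hh hv hr => ?_⟩
  obtain ⟨hz, hw⟩ := hmain h v (cellLeft h i) hh hv hr
  have hi := hv.integrable_relEnergy hγ hρb hB
  have hsplit : ∀ x, ∫ y in Iic x, relEnergy γ ρb (v y)
      = (∫ y in Iic (cellLeft h i), relEnergy γ ρb (v y))
        + ∫ y in cellLeft h i..x, relEnergy γ ρb (v y) := fun x => by
    have := intervalIntegral.integral_Iic_sub_Iic (a := cellLeft h i) (b := x)
      hi.integrableOn hi.integrableOn
    linarith
  obtain ⟨hl1, hl2⟩ := hv.leftEnergy_loss hγ hρb hB hh i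
  have hstep := hv.leftEnergy_stepMean hγ hρb hB hh i
  have hD := hv.cellRemainder_nonneg (γ := γ) hB hh (cellLeft h i)
  have hsum : cellRemainder γ h v (cellLeft h i) ≤ ∑' i : ℤ, cellRemainder γ h v (cellLeft h i) :=
    (hv.summable_cellRemainder hh).le_tsum i fun j _ => hv.cellRemainder_nonneg hB hh _
  constructor
  · intro C hC
    have := hz (C + ∫ y in Iic (cellLeft h i), relEnergy γ ρb (v y)) (by
      filter_upwards [hC] with x hx h1 h2
      have := hx h1 h2
      rw [hsplit] at this
      linarith)
    linarith
  · intro C hC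
    have := hw (C + ∫ y in Iic (cellLeft h i), relEnergy γ ρb (v y)) (by
      filter_upwards [hC] with x hx h1 h2
      have := hx h1 h2
      rw [hsplit] at this
      linarith)
    linarith

namespace Approx

variable {γ ρb ε δ B T : ℝ} {A : Approx}

/-! ### The approximate solution in the terms of cell averages -/

lemma node_eq_cellLeft (A : Approx) (i : ℤ) : A.node (2 * i - 1) = cellLeft A.dx i := by
  unfold node cellLeft; push_cast; ring

lemma node_eq_cellRight (A : Approx) (i : ℤ) : A.node (2 * i + 1) = cellLeft A.dx i + 2 * A.dx := by
  unfold node cellLeft; push_cast; ring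

lemma node_eq_cellMid (A : Approx) (i : ℤ) : A.node (2 * i) = cellLeft A.dx i + A.dx := by
  unfold node cellLeft; push_cast; ring

lemma avg_eq_cellMean (γ ρb : ℝ) (A : Approx) (n : ℕ) (i : ℤ) :
    A.avg γ ρb n (2 * i) = cellMean A.dx (A.before γ ρb n) (cellLeft A.dx i) := by
  unfold avg cellMean
  rw [node_eq_cellLeft, node_eq_cellRight]

lemma stepAvg_eq_stepMean (γ ρb : ℝ) (A : Approx) (n : ℕ) (x : ℝ) :
    A.stepAvg γ ρb n x = stepMean A.dx (A.before γ ρb n) x := by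
  unfold stepAvg cellIndex stepMean
  rw [avg_eq_cellMean]

lemma cellRemainder_eq (γ ρb : ℝ) (A : Approx) (n : ℕ) (i : ℤ) :
    1 / (2 * A.dx) * (∫ x in A.node (2 * i - 1)..A.node (2 * i + 1), ∫ y in A.node (2 * i - 1)..x,
      taylorRemainder γ (A.avg γ ρb n (2 * i)) (A.before γ ρb n y))
    = cellRemainder γ A.dx (A.before γ ρb n) (cellLeft A.dx i) := by
  unfold cellRemainder
  rw [node_eq_cellLeft, node_eq_cellRight, avg_eq_cellMean]

/-- The contribution to the functional `L` of the averaging at `t_n`. -/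
def averagingLoss (γ ρb : ℝ) (A : Approx) (n : ℕ) : ℝ :=
  (∫ x, (energy γ (A.before γ ρb n x) - energy γ (stepMean A.dx (A.before γ ρb n) x)))
    + ∑' i : ℤ, cellRemainder γ A.dx (A.before γ ρb n) (cellLeft A.dx i)

lemma functionalL_zero (γ ρb : ℝ) (A : Approx) :
    A.functionalL γ ρb 0 = A.averagingLoss γ ρb 0 := by
  simp only [functionalL, averagingLoss, cellRemainder_eq, stepAvg_eq_stepMean]
  simp

lemma functionalL_succ (γ ρb : ℝ) (A : Approx) (n : ℕ) :
    A.functionalL γ ρb (n + 1) = A.functionalL γ ρb n + A.production γ ρb n univ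
      + A.averagingLoss γ ρb (n + 1) := by
  simp only [functionalL, averagingLoss, cellRemainder_eq, stepAvg_eq_stepMean]
  rw [Finset.sum_range_succ _ n, Finset.sum_range_succ _ (n + 1), Finset.sum_range_succ _ (n + 1)]
  ring

/-! ### The initial data -/

lemma InitialData.isProfile (h : A.InitialData ρb B) : IsProfile ρb B A.u0 :=
  ⟨h.measurable.aemeasurable, h.far, h.bound⟩

lemma InitialData.bound_pos (h : A.InitialData ρb B) (hρb : 0 < ρb) : 0 < B := by
  obtain ⟨X, hX⟩ := h.far
  have hne : (ae (volume.restrict (Ioi |X|))).NeBot := by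
    rw [ae_neBot, Ne, Measure.restrict_eq_zero]; simp
  obtain ⟨x, hx, hxm⟩ := ((ae_restrict_of_ae (s := Ioi |X|) h.bound).and
    (ae_restrict_mem measurableSet_Ioi)).exists
  have h1 : X < |x| := (le_abs_self X).trans_lt (lt_of_lt_of_le hxm (le_abs_self x))
  rw [hX x h1] at hx
  exact hρb.trans_le hx.2.1

lemma InitialData.initEnergy_nonneg (h : A.InitialData ρb B) (hγ : 1 < γ) (hρb : 0 < ρb) :
    0 ≤ A.initEnergy γ ρb :=
  integral_nonneg_of_ae (h.bound.mono fun _ hx => relEnergy_nonneg hγ hρb hx.1)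

lemma initBound_pos (hγ : 1 < γ) (hρb : 0 < ρb) (A : Approx) : 0 < A.initBound γ ρb := by
  have hθ : 0 < theta γ := by unfold theta; linarith
  exact lt_of_lt_of_le (by positivity) (le_max_left _ _)

lemma dt_pos (h : A.InitialData ρb B) (hγ : 1 < γ) (hρb : 0 < ρb) (hdx : 0 < A.dx) :
    0 < A.dt γ ρb := by
  have h1 := h.initEnergy_nonneg hγ hρb
  have h2 := initBound_pos hγ hρb A
  unfold dt; positivity

lemma abs_velocity_add_le {γ : ℝ} (hγ : 1 < γ) (hB : 0 < B) {u : ℝ × ℝ} (hu : u ∈ Cone B) :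
    |u.2 / u.1| + u.1 ^ theta γ / theta γ ≤ invariantBound (theta γ) B := by
  have hθ : 0 < theta γ := by unfold theta; linarith
  have h1 := cone_velocity_le hB.le hu
  have h2 : u.1 ^ theta γ ≤ B ^ theta γ := Real.rpow_le_rpow hu.1 hu.2.1 hθ.le
  unfold invariantBound
  gcongr

lemma InitialData.leftEnergy_mem (h : A.InitialData ρb B) (hγ : 1 < γ) (hρb : 0 < ρb) (x : ℝ) :
    ∫ y in Iic x, relEnergy γ ρb (A.u0 y) ∈ Icc 0 (A.initEnergy γ ρb) := by
  have hnn : ∀ᵐ y, 0 ≤ relEnergy γ ρb (A.u0 y) :=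
    h.bound.mono fun _ hx => relEnergy_nonneg hγ hρb hx.1
  exact ⟨setIntegral_nonneg_of_ae hnn,
    setIntegral_le_integral (h.isProfile.integrable_relEnergy hγ hρb (h.bound_pos hρb)) hnn⟩

lemma InitialData.riemann_bounds (h : A.InitialData ρb B) (hγ : 1 < γ) (hρb : 0 < ρb) :
    ∀ᵐ x, -A.initBound γ ρb - A.initEnergy γ ρb + (∫ y in Iic x, relEnergy γ ρb (A.u0 y))
        ≤ riemannZ γ (A.u0 x) ∧
      riemannW γ (A.u0 x) ≤ A.initBound γ ρb + ∫ y in Iic x, relEnergy γ ρb (A.u0 y) := by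
  have hB := h.bound_pos hρb
  have hE := h.initEnergy_nonneg hγ hρb
  have hθ : 0 < theta γ := by unfold theta; linarith
  -- the essential infimum and supremum that enter `M_0` are those of essentially bounded functions
  have hz : IsBoundedUnder (· ≥ ·) (ae volume) (A.initZ γ ρb) := by
    refine ⟨-invariantBound (theta γ) B - A.initEnergy γ ρb, ?_⟩
    rw [eventually_map]
    filter_upwards [h.bound] with x hx
    have h1 := abs_velocity_add_le hγ hB hx
    have h2 := (h.leftEnergy_mem hγ hρb x).2
    have h3 := neg_abs_le ((A.u0 x).2 / (A.u0 x).1)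
    simp only [initZ, riemannZ, ge_iff_le]
    linarith
  have hw : IsBoundedUnder (· ≤ ·) (ae volume) (A.initW γ ρb) := by
    refine ⟨invariantBound (theta γ) B, ?_⟩
    rw [eventually_map]
    filter_upwards [h.bound] with x hx
    have h1 := abs_velocity_add_le hγ hB hx
    have h2 := (h.leftEnergy_mem hγ hρb x).1
    have h3 := le_abs_self ((A.u0 x).2 / (A.u0 x).1)
    simp only [initW, riemannW]
    linarith
  filter_upwards [ae_essInf_le hz, ae_le_essSup hw] with x h1 h2
  have h3 : -essInf (A.initZ γ ρb) volume + A.initEnergy γ ρb ≤ A.initBound γ ρb :=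
    (le_max_left _ _).trans (le_max_right _ _)
  have h4 : essSup (A.initW γ ρb) volume ≤ A.initBound γ ρb :=
    (le_max_right _ _).trans (le_max_right _ _)
  simp only [initZ, initW] at h1 h2
  constructor <;> linarith

/-! ### The state at the end of a strip -/

lemma time_strip (hdt : 0 < A.dt γ ρb) {n : ℕ} (hT : A.time γ ρb (n + 1) ≤ T) :
    A.time γ ρb n < A.time γ ρb (n + 1) ∧
      ∀ t ∈ Ioo (A.time γ ρb n) (A.time γ ρb (n + 1)), t ∈ Ico 0 T := by
  have h0 : 0 ≤ A.time γ ρb n := by unfold time; positivity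
  constructor
  · unfold time; push_cast; linarith
  · intro t ht; exact ⟨h0.trans ht.1.le, ht.2.trans_le hT⟩

lemma Piecewise.aemeasurable (hP : A.Piecewise γ ρb T) {n : ℕ} (hT : A.time γ ρb (n + 1) ≤ T)
    {t : ℝ} (ht : t ∈ Ioo (A.time γ ρb n) (A.time γ ρb (n + 1))) :
    AEMeasurable (fun x => A.u x t) := by
  set F : Set ℝ := range fun i => A.front n i t with hF
  have hFm : MeasurableSet Fᶜ := (Set.finite_range _).measurableSet.compl
  have hc : ContinuousOn (fun x => A.u x t) Fᶜ := by
    intro x hx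
    have h1 := hP.continuousAt n hT t ht x (fun i hi => hx ⟨i, hi.symm⟩)
    have h2 : ContinuousAt (fun y : ℝ => (y, t)) x := by fun_prop
    exact (ContinuousAt.comp (f := fun y : ℝ => (y, t)) h1 h2).continuousWithinAt
  have h3 := hc.aemeasurable (μ := volume) hFm
  rwa [Measure.restrict_eq_self_of_ae_mem] at h3
  exact compl_mem_ae_iff.2 ((Set.finite_range _).measure_zero _)

lemma isProfile_before_succ (hdt : 0 < A.dt γ ρb) (hD : A.DataBound B T) (hP : A.Piecewise γ ρb T)
    {n : ℕ} (hT : A.time γ ρb (n + 1) ≤ T) : IsProfile ρb B (A.before γ ρb (n + 1)) := by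
  obtain ⟨hlt, hmem⟩ := time_strip hdt hT
  have hev : ∀ᶠ t in 𝓝[<] A.time γ ρb (n + 1),
      t ∈ Ioo (A.time γ ρb n) (A.time γ ρb (n + 1)) := Ioo_mem_nhdsLT hlt
  have hbefore : ∀ x l, Tendsto (A.u x) (𝓝[<] A.time γ ρb (n + 1)) (𝓝 l) →
      A.before γ ρb (n + 1) x = l := by
    intro x l hl
    rw [before, if_neg (Nat.succ_ne_zero n)]
    exact leftLim_eq_of_tendsto hl
  refine ⟨?_, ?_, ?_⟩
  · obtain ⟨τ, -, hτ, hlim⟩ := exists_seq_strictMono_tendsto' hlt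
    refine aemeasurable_of_tendsto_metrizable_ae atTop
      (fun k => hP.aemeasurable hT (hτ k)) ?_
    filter_upwards [hP.time_limit n hT] with x ⟨l, hl⟩
    rw [hbefore x l hl]
    exact hl.comp (tendsto_nhdsWithin_iff.2 ⟨hlim, Eventually.of_forall fun k => (hτ k).2⟩)
  · obtain ⟨X, hX⟩ := hP.far
    refine ⟨X, fun x hx => hbefore x _ ?_⟩
    refine tendsto_const_nhds.congr' ?_
    filter_upwards [hev] with t ht
    exact (hX t (hmem t ht) x hx).symm
  · filter_upwards [hP.time_limit n hT] with x ⟨l, hl⟩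
    rw [hbefore x l hl]
    refine (isClosed_cone B).mem_of_tendsto hl ?_
    filter_upwards [hev] with t ht
    exact hD t (hmem t ht) x

/-! ### The entropy production of a strip -/

lemma intervalIntegrable_productionRate (hγ : 1 < γ) (hB : 0 < B) (hdt : 0 < A.dt γ ρb)
    (hD : A.DataBound B T) (hP : A.Piecewise γ ρb T) {n : ℕ} (hT : A.time γ ρb (n + 1) ≤ T)
    {S : Set ℝ} (hS : MeasurableSet S) :
    IntervalIntegrable (A.productionRate γ n S) volume (A.time γ ρb n) (A.time γ ρb (n + 1)) := by
  obtain ⟨hlt, hmem⟩ := time_strip hdt hT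
  set s := A.time γ ρb n
  set e := A.time γ ρb (n + 1)
  rw [intervalIntegrable_iff_integrableOn_Ioo_of_le hlt.le]
  unfold productionRate
  refine integrable_finsetSum _ fun i _ => ?_
  obtain ⟨l, hlc, hl⟩ := hP.left_trace n hT i
  obtain ⟨r, hrc, hr⟩ := hP.right_trace n hT i
  have hfr := hP.front_contDiff n hT i
  have hder : Continuous (deriv (A.front n i)) := hfr.continuous_deriv le_rfl
  have hlcone : ∀ t ∈ Ioo s e, l t ∈ Cone B := fun t ht =>
    (isClosed_cone B).mem_of_tendsto (hl t ht) (Eventually.of_forall fun y => hD t (hmem t ht) y)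
  have hrcone : ∀ t ∈ Ioo s e, r t ∈ Cone B := fun t ht =>
    (isClosed_cone B).mem_of_tendsto (hr t ht) (Eventually.of_forall fun y => hD t (hmem t ht) y)
  have hlm : AEMeasurable l (volume.restrict (Ioo s e)) := hlc.aemeasurable measurableSet_Ioo
  have hrm : AEMeasurable r (volume.restrict (Ioo s e)) := hrc.aemeasurable measurableSet_Ioo
  -- the rate in terms of the continuous traces
  set G : ℝ → ℝ := fun t => deriv (A.front n i) t * (energy γ (r t) - energy γ (l t))
    - (energyFlux γ (r t) - energyFlux γ (l t)) with hG
  have hGm : AEMeasurable G (volume.restrict (Ioo s e)) := by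
    have h1 := measurable_energy γ
    have h2 := measurable_energyFlux γ
    exact (hder.measurable.aemeasurable.mul
      ((h1.comp_aemeasurable hrm).sub (h1.comp_aemeasurable hlm))).sub
      ((h2.comp_aemeasurable hrm).sub (h2.comp_aemeasurable hlm))
  have hSm : MeasurableSet (A.front n i ⁻¹' S) := hfr.continuous.measurable hS
  obtain ⟨K, hK⟩ := (isCompact_Icc (a := s) (b := e)).exists_bound_of_continuousOn
    hder.continuousOn
  set Kη := B ^ 3 + 1 / (γ * (γ - 1)) * B ^ γ
  set Kq := B * B * (1 / 2 * B ^ 2 + B ^ (γ - 1) / (γ - 1))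
  have hGb : ∀ t ∈ Ioo s e, |G t| ≤ K * (2 * Kη) + 2 * Kq := by
    intro t ht
    have b1 := hK t (Ioo_subset_Icc_self ht)
    have b2 : _ ≤ Kη := abs_energy_le hγ hB.le (hlcone t ht)
    have b3 : _ ≤ Kη := abs_energy_le hγ hB.le (hrcone t ht)
    have b4 : _ ≤ Kq := abs_energyFlux_le hγ hB.le (hlcone t ht)
    have b5 : _ ≤ Kq := abs_energyFlux_le hγ hB.le (hrcone t ht)
    rw [Real.norm_eq_abs] at b1
    have b6 : |energy γ (r t) - energy γ (l t)| ≤ 2 * Kη := (abs_sub _ _).trans (by linarith)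
    have b7 : |energyFlux γ (r t) - energyFlux γ (l t)| ≤ 2 * Kq :=
      (abs_sub _ _).trans (by linarith)
    refine (abs_sub _ _).trans ?_
    rw [abs_mul]
    have := (abs_nonneg _).trans b1
    gcongr
  have hint : Integrable ((A.front n i ⁻¹' S).indicator G) (volume.restrict (Ioo s e)) := by
    refine Integrable.indicator (integrable_of_ae_abs_le hGm (K := K * (2 * Kη) + 2 * Kq) ?_) hSm
    rw [ae_restrict_iff' measurableSet_Ioo]
    exact Eventually.of_forall hGb
  refine hint.congr ?_
  rw [Filter.EventuallyEq, ae_restrict_iff' measurableSet_Ioo]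
  refine Eventually.of_forall fun t ht => ?_
  have hleft : Function.leftLim (fun y => A.u y t) (A.front n i t) = l t :=
    leftLim_eq_of_tendsto (hl t ht)
  have hright : Function.rightLim (fun y => A.u y t) (A.front n i t) = r t :=
    rightLim_eq_of_tendsto (hr t ht)
  by_cases hmS : A.front n i t ∈ S
  · rw [indicator_of_mem (show t ∈ A.front n i ⁻¹' S from hmS), indicator_of_mem hmS,
      jumpProduction, hleft, hright]
  · rw [indicator_of_notMem (show t ∉ A.front n i ⁻¹' S from hmS), indicator_of_notMem hmS]

lemma production_univ_eq (hγ : 1 < γ) (hB : 0 < B) (hdt : 0 < A.dt γ ρb)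
    (hD : A.DataBound B T) (hP : A.Piecewise γ ρb T) {n : ℕ} (hT : A.time γ ρb (n + 1) ≤ T)
    (a : ℝ) : A.production γ ρb n univ
      = A.production γ ρb n (Iio a) + A.production γ ρb n (Ici a) := by
  unfold production
  rw [← intervalIntegral.integral_add
    (intervalIntegrable_productionRate hγ hB hdt hD hP hT measurableSet_Iio)
    (intervalIntegrable_productionRate hγ hB hdt hD hP hT measurableSet_Ici)]
  congr 1
  ext t
  simp only [productionRate]
  rw [← Finset.sum_add_distrib]
  refine Finset.sum_congr rfl fun i _ => ?_
  by_cases h : A.front n i t < a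
  · simp [h]
  · simp [h, not_lt.1 h]

/-- The entropy condition for all discontinuities of a strip: the fronts stay to the right of some
point. -/
lemma neg_le_production_univ {e : ℝ} (hP : A.Piecewise γ ρb T) (hE : A.EntropyCondition γ ρb T e)
    {n : ℕ} (hT : A.time γ ρb (n + 1) ≤ T) : -e ≤ A.production γ ρb n univ := by
  have hb : ∀ i, ∃ a, ∀ t ∈ uIcc (A.time γ ρb n) (A.time γ ρb (n + 1)), a ≤ A.front n i t := by
    intro i
    obtain ⟨a, ha⟩ := (isCompact_uIcc.image (hP.front_contDiff n hT i).continuous).bddBelow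
    exact ⟨a, fun t ht => ha ⟨t, ht, rfl⟩⟩
  choose b hb using hb
  obtain ⟨a, ha⟩ := (Set.finite_range b).bddBelow
  have h := hE n hT a
  refine h.trans (le_of_eq ?_)
  unfold production
  refine intervalIntegral.integral_congr fun t ht => ?_
  simp only [productionRate]
  refine Finset.sum_congr rfl fun i _ => ?_
  have : A.front n i t ∈ Ici a := (ha ⟨i, rfl⟩).trans (hb i t ht)
  rw [indicator_of_mem this, indicator_of_mem (mem_univ _)]

/-! ### The bounds for the averages -/

/-- The bounds for the Riemann invariants of the averages, with the error `e` of the hypotheses kept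
apart. It enters twice: in the bounds before averaging, and in the sign of the entropy
production. -/
lemma exists_avg_error {μ B : ℝ} (hγ : 1 < γ) (hγ' : γ ≤ 5 / 3) (hρb : 0 < ρb)
    (hμ' : μ < 1 / (2 * theta γ)) (hB : 0 < B) :
    ∃ Ω : ℝ → ℝ, Ω =o[𝓝[>] 0] (fun h : ℝ => h) ∧
      ∀ (ε δ T e : ℝ) (A : Approx), 0 < A.dx →
        A.InitialData ρb B → A.DataBound B T → A.Piecewise γ ρb T →
        A.EntropyCondition γ ρb T e → A.RiemannBounds γ ρb ε δ T e →
        ∀ n : ℕ, A.time γ ρb n ≤ T → ∀ i : ℤ, A.dx ^ μ ≤ (A.avg γ ρb n (2 * i)).1 →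
          -A.boundM γ ρb ε δ n - A.initEnergy γ ρb - A.functionalL γ ρb n
              + A.leftEnergy γ ρb n (2 * i) - (|Ω A.dx| + 2 * |e|)
            ≤ riemannZ γ (A.avg γ ρb n (2 * i)) ∧
          riemannW γ (A.avg γ ρb n (2 * i))
            ≤ A.boundM γ ρb ε δ n + A.functionalL γ ρb n + A.leftEnergy γ ρb n (2 * i)
              + (|Ω A.dx| + 2 * |e|) := by
  obtain ⟨Ω, hΩ, hmain⟩ := exists_averaging_error hγ hγ' hρb hμ' hB
  refine ⟨Ω, hΩ, fun ε δ T e A hdx hI hD hP hE hR n hn i hr => ?_⟩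
  have hdt := dt_pos hI hγ hρb hdx
  have hΩ1 := le_abs_self (Ω A.dx)
  have he := le_abs_self e
  have he0 := abs_nonneg e
  have hleft : A.leftEnergy γ ρb n (2 * i) = ∫ x in Iic (cellLeft A.dx i + A.dx),
      relEnergy γ ρb (stepMean A.dx (A.before γ ρb n) x) := by
    unfold leftEnergy
    simp only [stepAvg_eq_stepMean, node_eq_cellMid]
  rw [avg_eq_cellMean] at hr
  rw [avg_eq_cellMean, hleft]
  cases n with
  | zero =>
    have hb0 : A.before γ ρb 0 = A.u0 := by ext1 x; simp [before]
    obtain ⟨hz, hw⟩ := hmain A.dx (A.before γ ρb 0) i hdx (by rw [hb0]; exact hI.isProfile) hr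
    have hri := hI.riemann_bounds hγ hρb
    have hz' := hz (-A.initBound γ ρb - A.initEnergy γ ρb) (by
      rw [hb0]; exact hri.mono fun x hx _ _ => hx.1)
    have hw' := hw (A.initBound γ ρb) (by
      rw [hb0]; exact hri.mono fun x hx _ _ => hx.2)
    rw [functionalL_zero, averagingLoss]
    have hM : A.boundM γ ρb ε δ 0 = A.initBound γ ρb := rfl
    rw [hM]
    constructor <;> linarith
  | succ k =>
    have hprof := isProfile_before_succ hdt hD hP hn
    obtain ⟨hz, hw⟩ := hmain A.dx (A.before γ ρb (k + 1)) i hdx hprof hr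
    have hri := hR k hn (2 * i) (even_two_mul i)
    rw [node_eq_cellLeft, node_eq_cellRight] at hri
    have hri' : ∀ᵐ x, x ∈ Ioc (cellLeft A.dx i) (cellLeft A.dx i + 2 * A.dx) →
        x ∈ Ico (cellLeft A.dx i) (cellLeft A.dx i + 2 * A.dx) := by
      filter_upwards [compl_mem_ae_iff.2
        (measure_singleton (μ := volume) (cellLeft A.dx i + 2 * A.dx))] with x hx hxm
      exact ⟨hxm.1.le, lt_of_le_of_ne hxm.2 hx⟩
    have hz' := hz (-A.boundM γ ρb ε δ (k + 1) - A.initEnergy γ ρb - A.functionalL γ ρb k - e) (by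
      filter_upwards [hri, hri'] with x h1 h2 h3 h4
      have := (h1 (h2 h3) h4).1
      linarith)
    have hw' := hw (A.boundM γ ρb ε δ (k + 1) + A.functionalL γ ρb k
        + A.production γ ρb k (Iio (cellLeft A.dx i + 2 * A.dx)) + e) (by
      filter_upwards [hri, hri'] with x h1 h2 h3 h4
      have := (h1 (h2 h3) h4).2
      linarith)
    have hp1 := neg_le_production_univ hP hE hn
    have hp2 := production_univ_eq hγ hB hdt hD hP hn (cellLeft A.dx i + 2 * A.dx)
    have hp3 := hE k hn (cellLeft A.dx i + 2 * A.dx)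
    rw [functionalL_succ, averagingLoss]
    constructor <;> linarith

end Approx

end IsentropicGas

end

theorem theorem3p2 (γ ρb μ B : ℝ) (hγ : 1 < γ) (hγ' : γ ≤ 5 / 3) (hρb : 0 < ρb)
    (hμ : 1 < μ) (hμ' : μ < 1 / (2 * IsentropicGas.theta γ))
    (ω : ℝ → ℝ) (hω : ω =o[𝓝[>] 0] (fun h : ℝ => h)) :
    ∃ ω' : ℝ → ℝ, ω' =o[𝓝[>] 0] (fun h : ℝ => h) ∧
      ∀ (ε δ T : ℝ) (A : IsentropicGas.Approx), 0 < ε → 0 < δ → 0 < T → 0 < A.dx →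
        A.InitialData ρb B → A.DataBound B T → A.Piecewise γ ρb T →
        A.EntropyCondition γ ρb T (ω A.dx) → A.RiemannBounds γ ρb ε δ T (ω A.dx) →
        ∀ n : ℕ, A.time γ ρb n ≤ T → ∀ j : ℤ, Even j →
          A.dx ^ μ ≤ (A.avg γ ρb n j).1 →
            (-A.boundM γ ρb ε δ n - A.initEnergy γ ρb - A.functionalL γ ρb n
                + A.leftEnergy γ ρb n j - ω' A.dx ≤ IsentropicGas.riemannZ γ (A.avg γ ρb n j) ∧
              IsentropicGas.riemannW γ (A.avg γ ρb n j)
                ≤ A.boundM γ ρb ε δ n + A.functionalL γ ρb n + A.leftEnergy γ ρb n j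
                  + ω' A.dx) ∧
            (0 ≤ A.cutZ γ ρb ε δ n j - IsentropicGas.riemannZ γ (A.avg γ ρb n j) ∧
              A.cutZ γ ρb ε δ n j - IsentropicGas.riemannZ γ (A.avg γ ρb n j) ≤ ω' A.dx) ∧
            (0 ≤ IsentropicGas.riemannW γ (A.avg γ ρb n j) - A.cutW γ ρb ε δ n j ∧
              IsentropicGas.riemannW γ (A.avg γ ρb n j) - A.cutW γ ρb ε δ n j ≤ ω' A.dx) := by
  rcases le_or_gt B 0 with hB | hB
  · -- the far-field density is at most `B`, so that `B` is positive
    refine ⟨0, isLittleO_zero _ _, fun ε δ T A _ _ _ _ hI => ?_⟩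
    exact absurd (hI.bound_pos hρb) (not_lt.2 hB)
  obtain ⟨Ω, hΩ, hmain⟩ := IsentropicGas.Approx.exists_avg_error hγ hγ' hρb hμ' hB
  refine ⟨fun h => |Ω h| + 2 * |ω h|, ?_, ?_⟩
  · exact hΩ.abs_left.add (hω.abs_left.const_mul_left 2)
  intro ε δ T A _ _ _ hdx hI hD hP hE hR n hn j hj hr
  obtain ⟨i, rfl⟩ : ∃ i, j = 2 * i := hj.imp fun i hi => by omega
  obtain ⟨hz, hw⟩ := hmain ε δ T (ω A.dx) A hdx hI hD hP hE hR n hn i hr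
  have hpos : 0 ≤ |Ω A.dx| + 2 * |ω A.dx| := by positivity
  refine ⟨⟨hz, hw⟩, ⟨?_, ?_⟩, ?_, ?_⟩
  · exact sub_nonneg.2 (le_max_left _ _)
  · rw [sub_le_iff_le_add, IsentropicGas.Approx.cutZ]
    exact max_le (by linarith) (by linarith)
  · exact sub_nonneg.2 (min_le_left _ _)
  · rw [sub_le_comm, IsentropicGas.Approx.cutW]
    exact le_min (by linarith) (by linarith)
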